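/- Let $\mathcal A$ be a finite alphabet. A *random substitution* $\vartheta$ assigns to each letter $a\in\mathcal A$ a non-empty finite set $\vartheta(a)$ of non-empty words over $\mathcal A$. For a word $v=v_1\cdots v_n$ put $\vartheta(v)=\{u_1\cdots u_n : u_i\in\vartheta(v_i)\}$, and let $\vartheta^0(a)=\{a\}$, $\vartheta^{p+1}(a)=\bigcup_{u\in\vartheta^p(a)}\vartheta(u)$. A non-empty word is *legal* if it is a subword of an element of $\vartheta^p(a)$ for some $a\in\mathcal A$, $p\ge 0$. The subshift $X_\vartheta\subseteq\mathcal A^{\mathbb Z}$ is the set of bi-infinite sequences all of whose non-empty finite subwords are legal, and $\operatorname{Aut}(X_\vartheta)$ is the group of self-homeomorphisms of $X_\vartheta$ that commute with the shift. $\vartheta$ is of *constant length* if all words in all the sets $\vartheta(a)$ have the same length; *compatible* if, for each $a$, any two words in $\vartheta(a)$ contain each letter the same number of times; *primitive* if there is $p\ge1$ such that for all $a,b\in\mathcal A$ the letter $a$ occurs in some word of $\vartheta^p(b)$; *non-degenerate* if $\#\vartheta(a)\ge 2$ for some letter $a$. An *inflation word decomposition* of a word $w$ is a pair $([u_1,\dots,u_\ell],v_1\cdots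 v_\ell)$ where the $u_i$ are non-empty words with $u_1\cdots u_\ell=w$, the $v_i$ are letters, the word $v_1\cdots v_\ell$ is legal, $u_i\in\vartheta(v_i)$ for $1<i<\ell$, $u_1$ is a suffix of a word in $\vartheta(v_1)$ and $u_\ell$ is a prefix of a word in $\vartheta(v_\ell)$ (for $\ell=1$: $u_1$ is a subword of a word in $\vartheta(v_1)$). It *induces* a decomposition on each non-empty subword $w_{[i,j]}$: keep those $u_m$, with their letters $v_m$, that meet the positions $i,\dots,j$, and truncate the first and the last of them to these positions. A legal word $u$ is *recognisable* if there is $N\ge 0$ such that, for every legal word $w=u^{(l)}uu^{(r)}$ with $|u^{(l)}|=|u^{(r)}|=N$, all inflation word decompositions of $w$ induce the same decomposition on the displayed occurrence of $u$. **Theorem.** Let $\vartheta$ be a non-degenerate, constant-length, primitive, compatible random substitution for which there is at least one recognisable word, and let $k\ge1$. Then the $k$-fold free product $(\mathbb Z/2\mathbb Z)^{*k}=\mathbb Z/2\mathbb Z*\cdots*\mathbb Z/2\mathbb Z$ embeds into $\operatorname{Aut}(X_\vartheta)$. Moreover, the free group $F_k$ on $k$ generators and the free group $F_\omega$ on countably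 infinitely many generators embed into $\operatorname{Aut}(X_\vartheta)$. -/

import Mathlib

/-- A random substitution on the alphabet `A`: every letter is sent to a non-empty finite set of
non-empty words. -/
structure RandomSubstitution (A : Type*) where
  /-- The set of inflation words of a letter. -/
  image : A → Finset (List A)
  image_nonempty : ∀ a, (image a).Nonempty
  ne_nil_of_mem : ∀ a, ∀ w ∈ image a, w ≠ []

namespace RandomSubstitution

/-- The set `ϑ(v)` of all realisations of `ϑ` on a word `v`: the concatenations `u₁ ⋯ uₙ` with
`uᵢ ∈ ϑ(vᵢ)`. -/
def onWord {A : Type*} (ϑ : RandomSubstitution A) : List A → Set (List A)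
  | [] => {[]}
  | a :: v => {w | ∃ u ∈ ϑ.image a, ∃ t ∈ ϑ.onWord v, w = u ++ t}

/-- The set `ϑ^p(a)` of level-`p` inflation words built from the letter `a`. -/
def power {A : Type*} (ϑ : RandomSubstitution A) : ℕ → A → Set (List A)
  | 0, a => {[a]}
  | p + 1, a => {w | ∃ u ∈ ϑ.power p a, w ∈ ϑ.onWord u}

/-- A non-empty word is legal if it is a subword of some `ϑ^p(a)`, `p ≥ 0`. -/
def IsLegal {A : Type*} (ϑ : RandomSubstitution A) (u : List A) : Prop :=
  u ≠ [] ∧ ∃ (a : A) (p : ℕ), ∃ v ∈ ϑ.power p a, u <:+: v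

/-- The finite word `u` is a subword of the bi-infinite sequence `x`. -/
def IsSubword {A : Type*} (u : List A) (x : ℤ → A) : Prop :=
  ∃ k : ℤ, ∀ i : Fin u.length, u.get i = x (k + (i : ℤ))

/-- The random substitution subshift `X_ϑ`. -/
def subshift {A : Type*} (ϑ : RandomSubstitution A) : Set (ℤ → A) :=
  {x | ∀ u : List A, u ≠ [] → IsSubword u x → ϑ.IsLegal u}

/-- The left shift on bi-infinite sequences. -/
def shift {A : Type*} (x : ℤ → A) : ℤ → A := fun i => x (i + 1)

theorem shift_mem_subshift {A : Type*} (ϑ : RandomSubstitution A) {x : ℤ → A}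
    (hx : x ∈ ϑ.subshift) : shift x ∈ ϑ.subshift := by
  rintro u hu ⟨k, hk⟩
  refine hx u hu ⟨k + 1, fun i => ?_⟩
  rw [hk i]
  simp only [shift]
  congr 1
  ring

/-- The shift action on `X_ϑ`. -/
def subshiftShift {A : Type*} (ϑ : RandomSubstitution A) (x : ϑ.subshift) : ϑ.subshift :=
  ⟨shift x.1, ϑ.shift_mem_subshift x.2⟩

/-- The automorphism group `Aut(X_ϑ)`: the self-homeomorphisms of `X_ϑ` (with the topology induced
by the product topology) that commute with the shift, under composition. -/
def autGroup {A : Type*} [TopologicalSpace A] (ϑ : RandomSubstitution A) :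
    Subgroup (ϑ.subshift ≃ₜ ϑ.subshift) where
  carrier := {h | ∀ x, h (ϑ.subshiftShift x) = ϑ.subshiftShift (h x)}
  mul_mem' := by
    intro f g hf hg x
    change f (g (ϑ.subshiftShift x)) = ϑ.subshiftShift (f (g x))
    rw [hg x, hf (g x)]
  one_mem' := fun _ => rfl
  inv_mem' := by
    intro f hf x
    change f.symm (ϑ.subshiftShift x) = ϑ.subshiftShift (f.symm x)
    apply f.injective
    rw [hf (f.symm x), f.apply_symm_apply, f.apply_symm_apply]

/-- Abelianisation: the number of occurrences of each letter in a word. -/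
def abelianisation {A : Type*} [DecidableEq A] (u : List A) : A → ℕ := fun c => u.count c

/-- All inflation words of the same letter have the same abelianisation. -/
def IsCompatible {A : Type*} [DecidableEq A] (ϑ : RandomSubstitution A) : Prop :=
  ∀ a, ∀ u ∈ ϑ.image a, ∀ v ∈ ϑ.image a, abelianisation u = abelianisation v

/-- For some `p ≥ 1`, every letter occurs in a level-`p` inflation word of every letter. -/
def IsPrimitive {A : Type*} (ϑ : RandomSubstitution A) : Prop :=
  ∃ p : ℕ, 1 ≤ p ∧ ∀ a b : A, ∃ u ∈ ϑ.power p b, a ∈ u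

/-- All inflation words of all letters have the same length. -/
def IsConstantLength {A : Type*} (ϑ : RandomSubstitution A) : Prop :=
  ∃ L : ℕ, ∀ a, ∀ u ∈ ϑ.image a, u.length = L

/-- Some letter has at least two inflation words, i.e. `ϑ` is not deterministic. -/
def IsNondegenerate {A : Type*} (ϑ : RandomSubstitution A) : Prop :=
  ∃ a, 2 ≤ (ϑ.image a).card

/-- `d = [(u₁, v₁), …, (u_ℓ, v_ℓ)]` encodes an inflation word decomposition
`([u₁, …, u_ℓ], v₁ ⋯ v_ℓ)` of the word `w`: the `uᵢ` are non-empty words with concatenation `w`,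
the root `v₁ ⋯ v_ℓ` is legal, `uᵢ ∈ ϑ(vᵢ)` for `1 < i < ℓ`, while `u₁` is a suffix of an inflation
word of `v₁` and `u_ℓ` is a prefix of an inflation word of `v_ℓ` (if `ℓ = 1`, then `u₁` is a
subword of an inflation word of `v₁`). Below, `p` and `s` are the parts of the inflation word that
stick out of `w` on the left and on the right. -/
def IsDecomposition {A : Type*} (ϑ : RandomSubstitution A) (w : List A)
    (d : List (List A × A)) : Prop :=
  (d.map Prod.fst).flatten = w ∧
  (∀ b ∈ d, b.1 ≠ []) ∧
  ϑ.IsLegal (d.map Prod.snd) ∧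
  ∀ i : Fin d.length, ∃ p s : List A,
    p ++ (d.get i).1 ++ s ∈ ϑ.image (d.get i).2 ∧
    ((i : ℕ) ≠ 0 → p = []) ∧
    ((i : ℕ) + 1 ≠ d.length → s = [])

/-- Remove the first `n` letters of the decomposed word from a decomposition. -/
def dropLetters {A : Type*} : ℕ → List (List A × A) → List (List A × A)
  | _, [] => []
  | n, (b, a) :: d =>
      if n < b.length then (b.drop n, a) :: d else dropLetters (n - b.length) d

/-- Keep only the first `n` letters of the decomposed word in a decomposition. -/
def takeLetters {A : Type*} : ℕ → List (List A × A) → List (List A × A)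
  | 0, _ => []
  | _ + 1, [] => []
  | n + 1, (b, a) :: d =>
      if n + 1 ≤ b.length then [(b.take (n + 1), a)]
      else (b, a) :: takeLetters (n + 1 - b.length) d

/-- The decomposition that `d` induces on the subword of length `n` which starts after the first
`m` letters. -/
def inducedDecomposition {A : Type*} (m n : ℕ) (d : List (List A × A)) : List (List A × A) :=
  takeLetters n (dropLetters m d)

/-- The legal word `u` is recognisable: for some `N`, the `N` letters to the left and to the right
of `u` determine the decomposition that is induced on `u`. -/
def IsRecognisableWord {A : Type*} (ϑ : RandomSubstitution A) (u : List A) : Prop :=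
  ϑ.IsLegal u ∧
  ∃ N : ℕ, ∀ l r : List A, l.length = N → r.length = N → ϑ.IsLegal (l ++ u ++ r) →
    ∀ d d' : List (List A × A),
      ϑ.IsDecomposition (l ++ u ++ r) d → ϑ.IsDecomposition (l ++ u ++ r) d' →
        inducedDecomposition N u.length d = inducedDecomposition N u.length d'

end RandomSubstitution

/-! Suppose a context `P _ Q` has finitely many contents that can be exchanged for each other
without leaving the subshift, and suppose that no occurrence of the context meets the content of
another. Then all contents can be rewritten simultaneously, and no context appears or disappears.

Let each content carry a label and a bit. For a label `i`, flip the bit of every context labelled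
`i` that has, within distance `D` on its right, a context with another label and bit `true`. This
rule reads only labels and the bits of contexts labelled differently, and it changes only bits at
label `i`; so it is an involution, and it is local and commutes with the shift. Given a reduced word
in these flips, take a chain of contexts, each seeing exactly the preceding one, labelled by the
letters of the word. The bit `true` moves one context further with every letter, so the word acts
non-trivially (`exists_foldr_flip_ne`). Hence the involutions generate a free product.

Such contexts exist for three reasons. A Baire argument gives a cylinder all of whose sequences are
cut into level-`p` inflation words at one offset (`exists_cylinder`). An extremal choice of letters
to the right of it forces one block to have a type with the same inflation words as a fixed letter
`c`, so that this block is exchangeable (`exists_exchange`). Finally, level-`q` inflation words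
outnumber any linear function of their length (`exists_lt_ncard_power`), so one of them can serve as
a marker that keeps occurrences apart (`exists_frameSystem`).

Three involutions suffice for the free groups: the free product of three copies of `ℤ/2ℤ` contains
`F₂`, which contains `F_ω`; both facts are read off from semidirect products. -/

namespace RandomSubstitution

/-! ### Finite windows of bi-infinite sequences. -/

section Words

variable {A : Type*}

/-- The subword of length `n` of the bi-infinite sequence `x` that starts at position `a`. -/
def word (x : ℤ → A) (a : ℤ) (n : ℕ) : List A := (List.range n).map fun i : ℕ => x (a + i)

@[simp] theorem length_word (x : ℤ → A) (a : ℤ) (n : ℕ) : (word x a n).length = n := by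
  simp [word]

@[simp] theorem word_zero (x : ℤ → A) (a : ℤ) : word x a 0 = [] := rfl

theorem getElem_word (x : ℤ → A) (a : ℤ) (n i : ℕ) (h : i < (word x a n).length) :
    (word x a n)[i] = x (a + i) := by
  simp [word]

theorem word_eq_word {x y : ℤ → A} {a b : ℤ} {n : ℕ} :
    word x a n = word y b n ↔ ∀ i : ℕ, i < n → x (a + i) = y (b + i) := by
  constructor
  · intro h i hi
    have h1 := getElem_word x a n i (by simpa using hi)
    have h2 := getElem_word y b n i (by simpa using hi)
    rw [← h1, ← h2]
    simp [h]
  · intro h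
    apply List.ext_getElem (by simp)
    intro i h1 h2
    rw [getElem_word, getElem_word]
    exact h i (by simpa using h1)

theorem word_congr {x y : ℤ → A} {a : ℤ} {n : ℕ}
    (h : ∀ i : ℤ, a ≤ i → i < a + n → x i = y i) : word x a n = word y a n :=
  word_eq_word.2 fun i hi => h _ (by omega) (by omega)

theorem apply_eq_of_word_eq {x y : ℤ → A} {a i : ℤ} {n : ℕ} (h : word x a n = word y a n)
    (h1 : a ≤ i) (h2 : i < a + n) : x i = y i := by
  have := word_eq_word.1 h (i - a).toNat (by omega)
  rwa [show a + ((i - a).toNat : ℤ) = i by omega] at this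

theorem word_add (x : ℤ → A) (a : ℤ) (m n : ℕ) :
    word x a (m + n) = word x a m ++ word x (a + m) n := by
  apply List.ext_getElem (by simp)
  intro i h1 h2
  rw [getElem_word, List.getElem_append]
  split
  · rw [getElem_word]
  · rename_i h
    rw [getElem_word]
    congr 1
    simp only [length_word, not_lt] at h ⊢
    push_cast [h]
    ring

theorem word_one (x : ℤ → A) (a : ℤ) : word x a 1 = [x a] := by
  simp [word]

theorem word_shift (x : ℤ → A) (a b : ℤ) (n : ℕ) :
    word (fun i => x (i + b)) a n = word x (a + b) n :=
  word_eq_word.2 fun i _ => by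
    rw [show a + (i : ℤ) + b = a + b + i by ring]

theorem word_infix {x : ℤ → A} {a b : ℤ} {m n : ℕ} (h1 : a ≤ b) (h2 : b + n ≤ a + m) :
    word x b n <:+: word x a m := by
  obtain ⟨s, hs⟩ := Int.eq_ofNat_of_zero_le (show 0 ≤ b - a by omega)
  obtain ⟨t, ht⟩ := Int.eq_ofNat_of_zero_le (show 0 ≤ a + m - (b + n) by omega)
  obtain rfl : m = s + n + t := by omega
  obtain rfl : b = a + s := by omega
  refine ⟨word x a s, word x (a + (s + n : ℕ)) t, ?_⟩
  rw [word_add, word_add]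

/-- Every finite word is a subword of some sequence, at any prescribed position. -/
theorem exists_word_eq [Nonempty A] (w : List A) (a : ℤ) : ∃ x, word x a w.length = w := by
  inhabit A
  refine ⟨fun i => w.getD (i - a).toNat default, ?_⟩
  apply List.ext_getElem (by simp)
  intro i h1 h2
  rw [getElem_word]
  simp [h2]

theorem word_append_iff {x : ℤ → A} {a : ℤ} {u v : List A} {n : ℕ} (hn : n = u.length + v.length) :
    word x a n = u ++ v ↔ word x a u.length = u ∧ word x (a + u.length) v.length = v := by
  subst hn
  rw [word_add]
  constructor
  · intro h
    exact List.append_inj h (by simp)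
  · rintro ⟨h1, h2⟩
    rw [h1, h2]

theorem isSubword_iff {u : List A} {x : ℤ → A} :
    IsSubword u x ↔ ∃ a, word x a u.length = u := by
  constructor
  · rintro ⟨k, hk⟩
    refine ⟨k, List.ext_getElem (by simp) fun i h1 h2 => ?_⟩
    rw [getElem_word]
    exact (hk ⟨i, h2⟩).symm
  · rintro ⟨k, hk⟩
    refine ⟨k, fun i => ?_⟩
    have := getElem_word x k u.length i (by simp)
    simp only [hk] at this
    exact this

end Words

/-! ### Concatenating choices letter by letter. -/

section Concatenation

variable {A : Type*}

/-- The concatenations `u₁ ⋯ uₙ` with `uᵢ ∈ S vᵢ`. -/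
def conc (S : A → Set (List A)) : List A → Set (List A)
  | [] => {[]}
  | a :: v => {w | ∃ u ∈ S a, ∃ t ∈ conc S v, w = u ++ t}

theorem onWord_eq_conc (ϑ : RandomSubstitution A) (v : List A) :
    ϑ.onWord v = conc (fun a => (ϑ.image a : Set (List A))) v := by
  induction v with
  | nil => rfl
  | cons a v ih => simp only [onWord, conc, ih]; rfl

theorem mem_conc_append {S : A → Set (List A)} {u v w : List A} :
    w ∈ conc S (u ++ v) ↔ ∃ s ∈ conc S u, ∃ t ∈ conc S v, w = s ++ t := by
  induction u generalizing w with
  | nil => simp [conc]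
  | cons a u ih =>
    simp only [List.cons_append, conc, Set.mem_ofPred_eq, ih]
    constructor
    · rintro ⟨p, hp, _, ⟨s, hs, t, ht, rfl⟩, rfl⟩
      exact ⟨p ++ s, ⟨p, hp, s, hs, rfl⟩, t, ht, by simp⟩
    · rintro ⟨_, ⟨p, hp, s, hs, rfl⟩, t, ht, rfl⟩
      exact ⟨p, hp, s ++ t, ⟨s, hs, t, ht, rfl⟩, by simp⟩

theorem mem_conc_singleton {S : A → Set (List A)} {a : A} {w : List A} :
    w ∈ conc S [a] ↔ w ∈ S a := by
  simp [conc]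

/-- Associativity of substitution; it makes levels add up in `mem_power_add`. -/
theorem conc_bind {S T : A → Set (List A)} {v w : List A} :
    w ∈ conc (fun a => {w | ∃ u ∈ S a, w ∈ conc T u}) v ↔ ∃ u ∈ conc S v, w ∈ conc T u := by
  induction v generalizing w with
  | nil => simp [conc]
  | cons a v ih =>
    simp only [conc, Set.mem_ofPred_eq, ih]
    constructor
    · rintro ⟨p, ⟨u, hu, hp⟩, t, ⟨r, hr, ht⟩, rfl⟩
      exact ⟨u ++ r, ⟨u, hu, r, hr, rfl⟩, mem_conc_append.2 ⟨p, hp, t, ht, rfl⟩⟩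
    · rintro ⟨_, ⟨u, hu, r, hr, rfl⟩, hw⟩
      obtain ⟨p, hp, t, ht, rfl⟩ := mem_conc_append.1 hw
      exact ⟨p, ⟨u, hu, hp⟩, t, ⟨r, hr, ht⟩, rfl⟩

theorem length_of_mem_conc {S : A → Set (List A)} {Λ : ℕ} (hS : ∀ a, ∀ u ∈ S a, u.length = Λ)
    {v w : List A} (hw : w ∈ conc S v) : w.length = v.length * Λ := by
  induction v generalizing w with
  | nil => simp_all [conc]
  | cons a v ih =>
    obtain ⟨u, hu, t, ht, rfl⟩ := hw
    rw [List.length_append, hS a u hu, ih ht, List.length_cons]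
    ring

theorem conc_nonempty {S : A → Set (List A)} (hS : ∀ a, (S a).Nonempty) (v : List A) :
    (conc S v).Nonempty := by
  induction v with
  | nil => exact ⟨[], rfl⟩
  | cons a v ih =>
    obtain ⟨t, ht⟩ := ih
    obtain ⟨u, hu⟩ := hS a
    exact ⟨u ++ t, u, hu, t, ht, rfl⟩

theorem conc_cons_eq_image (S : A → Set (List A)) (a : A) (v : List A) :
    conc S (a :: v) = (fun q : List A × List A => q.1 ++ q.2) '' (S a ×ˢ conc S v) := by
  ext w
  simp only [conc, Set.mem_ofPred_eq, Set.mem_image, Set.mem_prod, Prod.exists]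
  constructor
  · rintro ⟨u, hu, t, ht, rfl⟩
    exact ⟨u, t, ⟨hu, ht⟩, rfl⟩
  · rintro ⟨u, t, ⟨hu, ht⟩, rfl⟩
    exact ⟨u, hu, t, ht, rfl⟩

theorem conc_finite {S : A → Set (List A)} (hS : ∀ a, (S a).Finite) (v : List A) :
    (conc S v).Finite := by
  induction v with
  | nil => exact Set.finite_singleton _
  | cons a v ih =>
    rw [conc_cons_eq_image]
    exact ((hS a).prod ih).image _

theorem two_pow_le_ncard_conc {S : A → Set (List A)} {Λ : ℕ} (hS : ∀ a, ∀ u ∈ S a, u.length = Λ)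
    (h2 : ∀ a, 2 ≤ (S a).ncard) (v : List A) :
    2 ^ v.length ≤ (conc S v).ncard := by
  induction v with
  | nil => simp [conc]
  | cons a v ih =>
    rw [conc_cons_eq_image, Set.InjOn.ncard_image, Set.ncard_prod, List.length_cons, pow_succ,
      mul_comm]
    · exact Nat.mul_le_mul (h2 a) ih
    · rintro ⟨u, t⟩ ⟨hu, -⟩ ⟨u', t'⟩ ⟨hu', -⟩ h
      obtain ⟨rfl, rfl⟩ := List.append_inj h ((hS a u hu).trans (hS a u' hu').symm)
      rfl

/-- Blocks that are aligned with `o` and realise the letters of `v` concatenate. -/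
theorem word_mem_conc {S : A → Set (List A)} {Λ : ℕ} {x v : ℤ → A} {o a : ℤ} (n : ℕ)
    (h : ∀ i : ℕ, i < n → word x (o + i * Λ) Λ ∈ S (v (a + i))) :
    word x o (n * Λ) ∈ conc S (word v a n) := by
  induction n with
  | zero => simp [conc]
  | succ n ih =>
    rw [Nat.succ_mul, word_add, word_add, mem_conc_append]
    refine ⟨_, ih fun i hi => h i (by omega), _, ?_, rfl⟩
    rw [word_one, mem_conc_singleton]
    have := h n (by omega)
    push_cast
    exact this

theorem block_mem_of_mem_conc {S : A → Set (List A)} {Λ : ℕ}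
    (hS : ∀ a, ∀ u ∈ S a, u.length = Λ) {r : List A} {x v : ℤ → A} {o a : ℤ}
    (h : word x o (r.length * Λ) ∈ conc S r) (hv : word v a r.length = r) (i : ℕ)
    (hi : i < r.length) : word x (o + i * Λ) Λ ∈ S (v (a + i)) := by
  induction r generalizing o a i with
  | nil => simp at hi
  | cons b r ih =>
    obtain ⟨u, hu, t, ht, hut⟩ := h
    have hlen := hS b u hu
    rw [List.length_cons, Nat.succ_mul, add_comm, word_add] at hut
    obtain ⟨h1, h2⟩ := List.append_inj hut (by simp [hlen])
    rw [List.length_cons, add_comm, word_add, word_one] at hv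
    obtain ⟨hv1, hv2⟩ := List.cons.inj hv
    cases i with
    | zero =>
      simp only [Nat.cast_zero, zero_mul, add_zero]
      rw [hv1, h1]
      exact hu
    | succ i =>
      have := ih (o := o + Λ) (a := a + 1) (by rw [h2]; exact ht) (by simpa using hv2) i
        (by simpa using hi)
      push_cast
      rwa [show o + ((i : ℤ) + 1) * Λ = o + Λ + i * Λ by ring,
        show a + ((i : ℤ) + 1) = a + 1 + i by ring]

end Concatenation

/-! ### Level-`p` inflation words, legality and the subshift. -/

section Powers

variable {A : Type*} (ϑ : RandomSubstitution A)

theorem mem_conc_power_zero {v w : List A} : w ∈ conc (ϑ.power 0) v ↔ w = v := by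
  induction v generalizing w with
  | nil => simp [conc]
  | cons a v ih =>
    constructor
    · rintro ⟨u, rfl, t, ht, rfl⟩
      rw [ih.1 ht]
      rfl
    · rintro rfl
      exact ⟨[a], rfl, v, ih.2 rfl, rfl⟩

theorem mem_conc_power_succ {p : ℕ} {v w : List A} :
    w ∈ conc (ϑ.power (p + 1)) v ↔ ∃ u ∈ conc (ϑ.power p) v, w ∈ ϑ.onWord u := by
  have : ϑ.power (p + 1) =
      fun a => {w | ∃ u ∈ ϑ.power p a, w ∈ conc (fun a => (ϑ.image a : Set (List A))) u} := by
    funext a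
    simp only [power, onWord_eq_conc]
  rw [this, conc_bind]
  simp only [onWord_eq_conc]

theorem mem_power_add {p q : ℕ} {a : A} {w : List A} :
    w ∈ ϑ.power (p + q) a ↔ ∃ u ∈ ϑ.power p a, w ∈ conc (ϑ.power q) u := by
  induction q generalizing w with
  | zero => simp [mem_conc_power_zero]
  | succ q ih =>
    rw [← add_assoc]
    simp only [mem_conc_power_succ]
    change (∃ r ∈ ϑ.power (p + q) a, w ∈ ϑ.onWord r) ↔ _
    simp only [ih]
    constructor
    · rintro ⟨r, ⟨u, hu, hr⟩, hw⟩
      exact ⟨u, hu, r, hr, hw⟩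
    · rintro ⟨u, hu, r, hr, hw⟩
      exact ⟨r, ⟨u, hu, hr⟩, hw⟩

theorem power_nonempty (p : ℕ) (a : A) : (ϑ.power p a).Nonempty := by
  induction p with
  | zero => exact ⟨[a], rfl⟩
  | succ p ih =>
    obtain ⟨u, hu⟩ := ih
    obtain ⟨w, hw⟩ := conc_nonempty (S := fun a => (ϑ.image a : Set (List A)))
      (fun a => ϑ.image_nonempty a) u
    exact ⟨w, u, hu, by rwa [onWord_eq_conc]⟩

theorem power_finite (p : ℕ) (a : A) : (ϑ.power p a).Finite := by
  induction p with
  | zero => exact Set.finite_singleton _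
  | succ p ih =>
    have : ϑ.power (p + 1) a = ⋃ u ∈ ϑ.power p a, ϑ.onWord u := by
      ext w
      simp [power]
    rw [this]
    refine ih.biUnion fun u _ => ?_
    rw [onWord_eq_conc]
    exact conc_finite (fun a => Finset.finite_toSet _) u

variable {ϑ}

theorem length_of_mem_power {L : ℕ} (hL : ∀ a, ∀ u ∈ ϑ.image a, u.length = L) {p : ℕ} {a : A}
    {w : List A} (hw : w ∈ ϑ.power p a) : w.length = L ^ p := by
  induction p generalizing w with
  | zero => simp_all [power]
  | succ p ih =>
    obtain ⟨u, hu, hw⟩ := hw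
    rw [onWord_eq_conc] at hw
    rw [length_of_mem_conc (fun a u hu => hL a u (by simpa using hu)) hw, ih hu, pow_succ]

theorem IsLegal.of_infix {u v : List A} (hv : ϑ.IsLegal v) (h : u <:+: v) (hu : u ≠ []) :
    ϑ.IsLegal u := by
  obtain ⟨-, a, p, w, hw, hvw⟩ := hv
  exact ⟨hu, a, p, w, hw, h.trans hvw⟩

theorem isLegal_of_mem_power {p : ℕ} {a : A} {w : List A} (hw : w ∈ ϑ.power p a) (h : w ≠ []) :
    ϑ.IsLegal w :=
  ⟨h, a, p, w, hw, List.infix_refl _⟩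

theorem IsLegal.conc {p : ℕ} {v w : List A} (hv : ϑ.IsLegal v)
    (hw : w ∈ RandomSubstitution.conc (ϑ.power p) v) (h : w ≠ []) : ϑ.IsLegal w := by
  obtain ⟨-, a, q, r, hr, s, t, rfl⟩ := hv
  obtain ⟨s', hs'⟩ := conc_nonempty (ϑ.power_nonempty p) s
  obtain ⟨t', ht'⟩ := conc_nonempty (ϑ.power_nonempty p) t
  exact ⟨h, a, q + p, s' ++ w ++ t', ϑ.mem_power_add.2 ⟨_, hr, mem_conc_append.2
    ⟨s' ++ w, mem_conc_append.2 ⟨s', hs', w, hw, rfl⟩, t', ht', rfl⟩⟩, s', t', rfl⟩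

theorem mem_subshift_iff {x : ℤ → A} :
    x ∈ ϑ.subshift ↔ ∀ (a : ℤ) (n : ℕ), n ≠ 0 → ϑ.IsLegal (word x a n) := by
  constructor
  · intro h a n hn
    refine h _ (by simpa [← List.length_eq_zero_iff] using hn) (isSubword_iff.2 ⟨a, ?_⟩)
    rw [length_word]
  · intro h u hu hux
    obtain ⟨a, ha⟩ := isSubword_iff.1 hux
    rw [← ha]
    exact h a _ (by simpa using hu)

/-- It suffices to check arbitrarily long central windows. -/
theorem mem_subshift_of_windows {x : ℤ → A}
    (h : ∀ N : ℕ, ∃ (a : ℤ) (n : ℕ), a ≤ -N ∧ (N : ℤ) ≤ a + n ∧ ϑ.IsLegal (word x a n)) :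
    x ∈ ϑ.subshift := by
  rw [mem_subshift_iff]
  intro b m hm
  obtain ⟨a, n, h1, h2, h3⟩ := h (b.natAbs + m)
  exact h3.of_infix (word_infix (by omega) (by omega))
    (by simpa [← List.length_eq_zero_iff] using hm)

theorem translate_mem_subshift {x : ℤ → A} (hx : x ∈ ϑ.subshift) (b : ℤ) :
    (fun i => x (i + b)) ∈ ϑ.subshift := by
  rw [mem_subshift_iff] at hx ⊢
  intro a n hn
  rw [word_shift]
  exact hx _ n hn

end Powers

end RandomSubstitution

namespace RandomSubstitution

/-! ### Legal words: connecting, extending and desubstituting them. -/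

section Legal

variable {A : Type*} {ϑ : RandomSubstitution A}

theorem isLegal_singleton (ϑ : RandomSubstitution A) (a : A) : ϑ.IsLegal [a] :=
  ⟨by simp, a, 0, [a], rfl, List.infix_refl _⟩

/-- If `a` produces `u` at level `n`, primitivity puts `a` into a level-`p₀` word of every letter,
so level `p₀ + n` works for all letters at once. At a higher level, apply this to the first letter
of an intermediate word. -/
theorem IsPrimitive.exists_infix (hp : ϑ.IsPrimitive) {u : List A} (hu : ϑ.IsLegal u) :
    ∃ P, ∀ p, P ≤ p → ∀ b, ∃ w ∈ ϑ.power p b, u <:+: w := by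
  obtain ⟨p₀, -, hp⟩ := hp
  obtain ⟨-, a, n, v, hv, huv⟩ := hu
  refine ⟨p₀ + n, fun p hP b => ?_⟩
  obtain ⟨j, rfl⟩ := Nat.exists_eq_add_of_le hP
  obtain ⟨r, hr⟩ := ϑ.power_nonempty j b
  -- The default `b` concerns only an empty `r`, which is excluded below.
  obtain ⟨z, hz⟩ : ∃ z ∈ conc (ϑ.power (p₀ + n)) [(r.head?.getD b)], u <:+: z := by
    obtain ⟨w, hw, haw⟩ := hp a (r.head?.getD b)
    obtain ⟨s, t, rfl⟩ := List.append_of_mem haw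
    obtain ⟨s', hs'⟩ := conc_nonempty (ϑ.power_nonempty n) s
    obtain ⟨t', ht'⟩ := conc_nonempty (ϑ.power_nonempty n) t
    refine ⟨s' ++ (v ++ t'), ?_, ?_⟩
    · rw [mem_conc_singleton, mem_power_add]
      exact ⟨_, hw, mem_conc_append.2 ⟨s', hs', v ++ t', ⟨v, hv, t', ht', rfl⟩, rfl⟩⟩
    · exact huv.trans ⟨s', t', by simp⟩
  cases r with
  | nil =>
    exfalso
    clear hz
    have : ∀ (j : ℕ) (b : A), [] ∉ ϑ.power j b := by
      intro j
      induction j with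
      | zero => intro b h; simp [power] at h
      | succ j ih =>
        intro b h
        obtain ⟨u, hu, h⟩ := h
        cases u with
        | nil => exact ih b hu
        | cons c u =>
          obtain ⟨s, hs, t, -, hst⟩ := h
          exact ϑ.ne_nil_of_mem c s hs (List.append_eq_nil_iff.1 hst.symm).1
    exact this j b hr
  | cons c r =>
    obtain ⟨t', ht'⟩ := conc_nonempty (ϑ.power_nonempty (p₀ + n)) r
    refine ⟨z ++ t', ?_, hz.2.trans ⟨[], t', by simp⟩⟩
    rw [add_comm, mem_power_add]
    exact ⟨_, hr, z, mem_conc_singleton.1 hz.1, t', ht', rfl⟩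

/-- At length one, compatibility would make all inflation words of a letter equal. -/
theorem two_le_length [DecidableEq A] (hc : ϑ.IsCompatible) (hn : ϑ.IsNondegenerate) {L : ℕ}
    (hL : ∀ a, ∀ u ∈ ϑ.image a, u.length = L) : 2 ≤ L := by
  obtain ⟨a, ha⟩ := hn
  obtain ⟨u, hu, v, hv, huv⟩ := Finset.one_lt_card.1 ha
  by_contra! h
  have h1 := hL a u hu
  have h2 := hL a v hv
  interval_cases L
  · exact ϑ.ne_nil_of_mem a u hu (List.length_eq_zero_iff.1 h1)
  · obtain ⟨b, rfl⟩ := List.length_eq_one_iff.1 h1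
    obtain ⟨c, rfl⟩ := List.length_eq_one_iff.1 h2
    have := congrFun (hc a _ hu _ hv) b
    simp only [abelianisation, List.count_singleton, beq_self_eq_true, if_true] at this
    split_ifs at this with hbc
    exact huv (by rw [show c = b by simpa using hbc])

/-- Any inflation word begins with a legal pair `b c`; inflate `b` to a word containing `u` and `c`
to one containing `v`. -/
theorem exists_append_append (hp : ϑ.IsPrimitive) {L : ℕ} (h2 : 2 ≤ L)
    (hL : ∀ a, ∀ u ∈ ϑ.image a, u.length = L) {u v : List A} (hu : ϑ.IsLegal u)
    (hv : ϑ.IsLegal v) : ∃ g, ϑ.IsLegal (u ++ g ++ v) := by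
  obtain ⟨P, hP⟩ := hp.exists_infix hu
  obtain ⟨Q, hQ⟩ := hp.exists_infix hv
  obtain ⟨a, ha⟩ : ∃ a : A, True := by
    obtain ⟨-, a, -⟩ := hu
    exact ⟨a, trivial⟩
  obtain ⟨z, hz⟩ := ϑ.power_nonempty 1 a
  have hzl := length_of_mem_power hL hz
  match z, hz with
  | [], hz => simp at hzl; omega
  | [b], hz => simp at hzl; omega
  | b :: c :: z, hz =>
    have hbc : ϑ.IsLegal [b, c] :=
      (isLegal_of_mem_power hz (by simp)).of_infix ⟨[], z, by simp⟩ (by simp)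
    obtain ⟨w, hw, s, t, rfl⟩ := hP (max P Q) (le_max_left _ _) b
    obtain ⟨w', hw', s', t', rfl⟩ := hQ (max P Q) (le_max_right _ _) c
    have hu0 := hu.1
    refine ⟨t ++ s', IsLegal.of_infix (hbc.conc (p := max P Q) (w := (s ++ u ++ t) ++ (s' ++ v ++ t'))
      ⟨_, hw, _, mem_conc_singleton.2 hw', rfl⟩ (by simp [hu0])) ⟨s, t', by simp⟩ (by simp [hu0])⟩

theorem exists_cons_append_singleton (hp : ϑ.IsPrimitive) {L : ℕ} (h2 : 2 ≤ L)
    (hL : ∀ a, ∀ u ∈ ϑ.image a, u.length = L) {u : List A} (hu : ϑ.IsLegal u) :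
    ∃ c d, ϑ.IsLegal (c :: (u ++ [d])) := by
  obtain ⟨-, a, -⟩ := id hu
  have ha := isLegal_singleton ϑ a
  obtain ⟨g, hg⟩ := exists_append_append hp h2 hL ha hu
  obtain ⟨g', hg'⟩ := exists_append_append hp h2 hL hg ha
  obtain ⟨s, c, hs⟩ : ∃ s c, [a] ++ g = s ++ [c] :=
    ⟨_, _, (List.dropLast_append_getLast (by simp)).symm⟩
  obtain ⟨d, t, ht⟩ : ∃ d t, g' ++ [a] = d :: t := List.exists_cons_of_ne_nil (by simp)
  refine ⟨c, d, hg'.of_infix ⟨s, t, ?_⟩ (by simp)⟩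
  rw [List.append_assoc _ g' [a], ht, hs]
  simp

/-- Every legal word occurs in some element of the subshift. -/
theorem exists_mem_subshift_word_eq (hp : ϑ.IsPrimitive) {L : ℕ} (h2 : 2 ≤ L)
    (hL : ∀ a, ∀ u ∈ ϑ.image a, u.length = L) {u : List A} (hu : ϑ.IsLegal u) (a : ℤ) :
    ∃ x ∈ ϑ.subshift, word x a u.length = u := by
  suffices h : ∃ x ∈ ϑ.subshift, word x 0 u.length = u by
    obtain ⟨x, hx, hxu⟩ := h
    refine ⟨fun i => x (i + (-a)), translate_mem_subshift hx _, ?_⟩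
    rw [word_shift, add_neg_cancel, hxu]
  choose c d hcd using fun v : {v // ϑ.IsLegal v} => exists_cons_append_singleton hp h2 hL v.2
  -- `E n` extends `u` by `n` letters on each side. Laid out from position `-n`, these words agree
  -- wherever they overlap.
  let E : ℕ → {v // ϑ.IsLegal v} := fun n => Nat.rec ⟨u, hu⟩ (fun _ v => ⟨_, hcd v⟩) n
  have hE : ∀ n, (E (n + 1)).1 = c (E n) :: ((E n).1 ++ [d (E n)]) := fun n => rfl
  have hlen : ∀ n, (E n).1.length = u.length + 2 * n := by
    intro n
    induction n with
    | zero => rfl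
    | succ n ih => rw [hE]; simp [ih]; ring
  have hupos : 0 < u.length := List.length_pos_iff.2 hu.1
  have hstep : ∀ (n m k : ℕ), k < u.length + 2 * n →
      (E (n + m)).1[k + m]? = (E n).1[k]? := by
    intro n m k hk
    induction m with
    | zero => rfl
    | succ m ih =>
      rw [← add_assoc, ← add_assoc, hE, List.getElem?_cons_succ, List.getElem?_append_left, ih]
      rw [hlen]
      omega
  let x : ℤ → A := fun i => (E i.natAbs).1[(i + i.natAbs).toNat]'(by rw [hlen]; omega)
  have hxs : ∀ i, some (x i) = (E i.natAbs).1[(i + i.natAbs).toNat]? := fun i =>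
    (List.getElem?_eq_getElem _).symm
  have hx : ∀ (n : ℕ), word x (-n) (u.length + 2 * n) = (E n).1 := by
    intro n
    apply List.ext_getElem (by simp [hlen])
    intro j h1 h2'
    rw [getElem_word]
    rw [length_word] at h1
    apply Option.some_injective
    rw [hxs, ← List.getElem?_eq_getElem]
    set i : ℤ := -n + j with hi
    rcases le_total i.natAbs n with h | h
    · obtain ⟨m, hm⟩ := Nat.exists_eq_add_of_le h
      rw [← hstep i.natAbs m _ (by omega), ← hm]
      congr 1
      omega
    · obtain ⟨m, hm⟩ := Nat.exists_eq_add_of_le h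
      rw [← hstep n m _ (by omega), ← hm]
      congr 1
      omega
  refine ⟨x, mem_subshift_of_windows fun N => ⟨-N, u.length + 2 * N, le_rfl, ?_, ?_⟩, ?_⟩
  · push_cast
    omega
  · rw [hx]
    exact (E N).2
  · have := hx 0
    rwa [Nat.cast_zero, neg_zero, mul_zero, add_zero] at this

/-- A legal stretch of `x` is cut, at some offset, into level-`p` inflation words whose types form
legal words. -/
theorem exists_blocks [Nonempty A] (hp : ϑ.IsPrimitive) {L : ℕ} (h2 : 2 ≤ L)
    (hL : ∀ a, ∀ u ∈ ϑ.image a, u.length = L) (p : ℕ) {x : ℤ → A} {a : ℤ} {n : ℕ}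
    (h : ϑ.IsLegal (word x a n)) :
    ∃ (v : ℤ → A) (o : ℤ), 0 ≤ o ∧ o < (L ^ p : ℕ) ∧
      (∀ i : ℤ, a ≤ o + i * (L ^ p : ℕ) → o + i * (L ^ p : ℕ) + (L ^ p : ℕ) ≤ a + n →
        word x (o + i * (L ^ p : ℕ)) (L ^ p) ∈ ϑ.power p (v i)) ∧
      ∀ (i : ℤ) (m : ℕ), m ≠ 0 → a ≤ o + i * (L ^ p : ℕ) →
        o + (i + m) * (L ^ p : ℕ) ≤ a + n → ϑ.IsLegal (word v i m) := by
  obtain ⟨P, hP⟩ := hp.exists_infix h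
  inhabit A
  -- A level-`(P + p)` word containing the stretch is a level-`p` inflation of a level-`P` word `r`;
  -- the letters of `r` are the types of the blocks.
  obtain ⟨w, hw, s, t, hst⟩ := hP (P + p) (by omega) default
  obtain ⟨r, hr, hwr⟩ := ϑ.mem_power_add.1 hw
  have hΛ : 0 < L ^ p := Nat.pow_pos (by omega)
  generalize hΛe : L ^ p = Λ at hΛ
  have hS : ∀ a, ∀ u ∈ ϑ.power p a, u.length = Λ := fun a u hu => by
    rw [length_of_mem_power hL hu, hΛe]
  have hwl := length_of_mem_conc hS hwr
  obtain ⟨y, hy⟩ := exists_word_eq w (a - s.length)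
  have hsn : s.length + n + t.length = w.length := by
    rw [← hst]
    simp [add_assoc]
  have hxy : ∀ i, a ≤ i → i < a + n → y i = x i := by
    have h1 : word y (a - s.length) w.length = s ++ (word x a n ++ t) := by
      rw [hy, ← hst, List.append_assoc]
    rw [word_append_iff (by simp; omega), word_append_iff (by simp)] at h1
    have h3 := h1.2.1
    rw [length_word, sub_add_cancel] at h3
    intro i hi1 hi2
    exact apply_eq_of_word_eq h3 hi1 hi2
  set B : ℤ := a - s.length with hB
  -- The first block of `w` receives index `k`, which brings the offset `B % Λ` into `[0, Λ)`.
  set k : ℤ := B / Λ with hk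
  have hBk : B = B % Λ + k * Λ := by rw [hk]; linarith [Int.emod_add_mul_ediv B Λ, mul_comm (B / Λ) (Λ : ℤ)]
  obtain ⟨v, hv⟩ := exists_word_eq r k
  have hΛ' : (0 : ℤ) < Λ := by exact_mod_cast hΛ
  have hBw : B + (r.length : ℤ) * Λ = a + n + t.length := by
    have : ((s.length + n + t.length : ℕ) : ℤ) = (r.length * Λ : ℕ) := by rw [hsn, hwl]
    push_cast at this
    rw [← this, hB]
    ring
  have hlow : ∀ i : ℤ, a ≤ B % Λ + i * Λ → k ≤ i := by
    intro i hi
    have : k * Λ ≤ i * Λ := by omega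
    exact le_of_mul_le_mul_right this hΛ'
  have hup : ∀ i : ℤ, B % Λ + i * Λ ≤ a + n → i ≤ k + r.length := by
    intro i hi
    have : i * Λ ≤ (k + r.length) * Λ := by rw [add_mul]; omega
    exact le_of_mul_le_mul_right this hΛ'
  refine ⟨v, B % Λ, Int.emod_nonneg _ hΛ'.ne', Int.emod_lt_of_pos _ hΛ', fun i h1 h2 => ?_,
    fun i m hm h1 h2 => ?_⟩
  · have hi1 := hlow i h1
    have hi2 := hup (i + 1) (by rw [add_mul]; omega)
    obtain ⟨j, hj⟩ := Int.eq_ofNat_of_zero_le (show 0 ≤ i - k by omega)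
    obtain rfl : i = k + j := by omega
    have := block_mem_of_mem_conc hS (x := y) (o := B) (by rwa [← hwl, hy]) hv j (by omega)
    rw [show B + (j : ℤ) * Λ = B % Λ + (k + j) * Λ by rw [add_mul]; omega] at this
    rw [← word_congr (x := y)]
    · exact this
    · intro i' h3 h4
      exact hxy i' (by omega) (by omega)
  · have hi1 := hlow i h1
    have hi2 := hup _ h2
    have hr0 : r ≠ [] := by
      rintro rfl
      simp at hi2
      omega
    refine (isLegal_of_mem_power hr hr0).of_infix ?_ (by simpa [← List.length_eq_zero_iff] using hm)
    rw [← hv]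
    exact word_infix hi1 hi2

end Legal

/-! ### Letter counts and the number of inflation words. -/

section Counting

variable {A : Type*} {ϑ : RandomSubstitution A}

/-- By `key`, the letter counts of an inflated word are a sum over the letters of its root, so they
depend only on the letter counts of that root; induct on the level. -/
theorem IsCompatible.count_eq [DecidableEq A] (hc : ϑ.IsCompatible) {p : ℕ} {b : A}
    {u v : List A} (hu : u ∈ ϑ.power p b) (hv : v ∈ ϑ.power p b) (c : A) :
    u.count c = v.count c := by
  choose rep hrep using ϑ.image_nonempty
  have key : ∀ (r w : List A), w ∈ ϑ.onWord r →
      ∀ c, w.count c = (r.map fun a => (rep a).count c).sum := by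
    intro r
    induction r with
    | nil => rintro w rfl c; simp
    | cons a r ih =>
      rintro _ ⟨u, hu, t, ht, rfl⟩ c
      rw [List.count_append, ih t ht c, List.map_cons, List.sum_cons]
      congr 1
      exact congrFun (hc a u hu (rep a) (hrep a)) c
  induction p generalizing u v c with
  | zero => simp_all [power]
  | succ p ih =>
    obtain ⟨r, hr, hu⟩ := hu
    obtain ⟨r', hr', hv⟩ := hv
    rw [key r u hu, key r' v hv]
    exact ((List.perm_iff_count.2 fun c => ih hr hr' c).map _).sum_eq

theorem exists_forall_mem_of_mem_power [DecidableEq A] (hc : ϑ.IsCompatible)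
    (hp : ϑ.IsPrimitive) : ∃ p, 1 ≤ p ∧ ∀ b, ∀ w ∈ ϑ.power p b, ∀ a, a ∈ w := by
  obtain ⟨p, h1, hp⟩ := hp
  refine ⟨p, h1, fun b w hw a => ?_⟩
  obtain ⟨u, hu, hau⟩ := hp a b
  rw [← List.count_pos_iff] at hau ⊢
  rwa [hc.count_eq hw hu]

/-- Long legal words contain every letter. -/
theorem exists_forall_mem_of_isLegal [DecidableEq A] (hc : ϑ.IsCompatible)
    (hp : ϑ.IsPrimitive) {L : ℕ} (h2 : 2 ≤ L) (hL : ∀ a, ∀ u ∈ ϑ.image a, u.length = L) :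
    ∃ m, m ≠ 0 ∧ ∀ (x : ℤ → A) (a : ℤ), ϑ.IsLegal (word x a m) → ∀ c, c ∈ word x a m := by
  obtain ⟨p, -, hpm⟩ := exists_forall_mem_of_mem_power hc hp
  have hΛ : 0 < L ^ p := Nat.pow_pos (by omega)
  -- Twice the block length leaves room for a complete block, whatever the offset.
  refine ⟨2 * L ^ p, by omega, fun x a hx c => ?_⟩
  have : Nonempty A := ⟨c⟩
  obtain ⟨v, o, ho, ho', hb, -⟩ := exists_blocks hp h2 hL p hx
  generalize L ^ p = Λ at *
  have hΛ' : (0 : ℤ) < Λ := by exact_mod_cast hΛ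
  set i : ℤ := (a - o) / Λ + 1 with hi
  have h1 := Int.emod_add_mul_ediv (a - o) Λ
  have h3 := Int.emod_nonneg (a - o) hΛ'.ne'
  have h4 := Int.emod_lt_of_pos (a - o) hΛ'
  have h5 : i * Λ = Λ * ((a - o) / Λ) + Λ := by rw [hi]; ring
  exact (word_infix (by omega) (by push_cast; omega)).subset
    (hpm _ _ (hb i (by omega) (by push_cast; omega)) c)

/-- A letter with two inflation words occurs in the level-`p` words of all letters; vary the choice
at one occurrence and keep everything else fixed. -/
theorem exists_two_le_ncard_power [DecidableEq A] (hc : ϑ.IsCompatible)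
    (hp : ϑ.IsPrimitive) (hn : ϑ.IsNondegenerate) :
    ∃ p, 1 ≤ p ∧ ∀ b, 2 ≤ (ϑ.power p b).ncard := by
  obtain ⟨p, -, hpm⟩ := exists_forall_mem_of_mem_power hc hp
  obtain ⟨a, ha⟩ := hn
  obtain ⟨u, hu, v, hv, huv⟩ := Finset.one_lt_card.1 ha
  refine ⟨p + 1, by omega, fun b => ?_⟩
  obtain ⟨w, hw⟩ := ϑ.power_nonempty p b
  obtain ⟨s, t, rfl⟩ := List.append_of_mem (hpm b w hw a)
  obtain ⟨s', hs'⟩ := conc_nonempty (S := fun a => (ϑ.image a : Set (List A)))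
    (fun a => ϑ.image_nonempty a) s
  obtain ⟨t', ht'⟩ := conc_nonempty (S := fun a => (ϑ.image a : Set (List A)))
    (fun a => ϑ.image_nonempty a) t
  have key : ∀ z ∈ ϑ.image a, s' ++ (z ++ t') ∈ ϑ.power (p + 1) b := fun z hz => by
    refine ⟨_, hw, ?_⟩
    rw [onWord_eq_conc]
    exact mem_conc_append.2 ⟨s', hs', z ++ t', ⟨z, hz, t', ht', rfl⟩, rfl⟩
  exact (Set.one_lt_ncard (ϑ.power_finite _ _)).2 ⟨_, key u hu, _, key v hv, by simpa using huv⟩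

/-- The number of level-`q` inflation words grows faster than linearly in their length. -/
theorem exists_lt_ncard_power [DecidableEq A] (hc : ϑ.IsCompatible)
    (hp : ϑ.IsPrimitive) (hn : ϑ.IsNondegenerate) {L : ℕ} (h2 : 2 ≤ L)
    (hL : ∀ a, ∀ u ∈ ϑ.image a, u.length = L) (C : ℕ) :
    ∃ q, ∀ b, C * (L ^ q + C) < (ϑ.power q b).ncard := by
  obtain ⟨p, h1, h⟩ := exists_two_le_ncard_power hc hp hn
  -- Independent choices at the `L ^ n` letters of a level-`n` word give at least `2 ^ (L ^ n)`
  -- words, whose length is only `L ^ p` times as large. The summand 4 secures `N ^ 2 ≤ 2 ^ N` for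
  -- `N = L ^ n`, and `n < N` absorbs `C * (L ^ p + C)`.
  set n := C * (L ^ p + C) + 4 with hnn
  refine ⟨n + p, fun b => ?_⟩
  obtain ⟨w, hw⟩ := ϑ.power_nonempty n b
  have hsub : conc (ϑ.power p) w ⊆ ϑ.power (n + p) b := fun z hz => ϑ.mem_power_add.2 ⟨w, hw, hz⟩
  have h3 := (two_pow_le_ncard_conc (fun a u hu => length_of_mem_power hL hu) h w).trans
    (Set.ncard_le_ncard hsub (ϑ.power_finite _ _))
  rw [length_of_mem_power hL hw] at h3
  have h4 : n < L ^ n := Nat.lt_pow_self (by omega)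
  have h5 : (L ^ n) ^ 2 ≤ 2 ^ (L ^ n) := by
    have : ∀ N : ℕ, 4 ≤ N → N ^ 2 ≤ 2 ^ N := by
      intro N hN
      induction N, hN using Nat.le_induction with
      | base => norm_num
      | succ N hN ih => rw [pow_succ 2 N]; nlinarith
    exact this _ (by omega)
  rw [pow_add]
  generalize L ^ n = N at *
  refine lt_of_lt_of_le ?_ (h5.trans h3)
  calc C * (N * L ^ p + C) ≤ C * (N * L ^ p + N * C) := by
        gcongr
        exact Nat.le_mul_of_pos_left _ (by omega)
    _ = N * (C * (L ^ p + C)) := by ring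
    _ < N * N := by
        apply Nat.mul_lt_mul_of_pos_left <;> omega
    _ = N ^ 2 := by ring

end Counting

end RandomSubstitution

namespace RandomSubstitution

/-! ### Common cutting offsets and exchangeable blocks. -/

section Cutting

variable {A : Type*}

/-- The blocks of length `Λ` of `x` that are aligned with `o` and have an index of absolute value at
most `n` are level-`p` inflation words, and their types form a legal word. -/
def IsCutOn (ϑ : RandomSubstitution A) (p Λ : ℕ) (x : ℤ → A) (o : ℤ) (n : ℕ) : Prop :=
  ∃ v : ℤ → A, ϑ.IsLegal (word v (-n) (2 * n + 1)) ∧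
    ∀ i : ℤ, -n ≤ i → i ≤ n → word x (o + i * Λ) Λ ∈ ϑ.power p (v i)

variable {ϑ : RandomSubstitution A} {p Λ : ℕ} {x y : ℤ → A} {o : ℤ} {n m : ℕ}

theorem add_mul_le_of_lt {Λ : ℕ} {i j : ℤ} (h : i < j) : i * Λ + Λ ≤ j * Λ := by
  have : (i + 1) * Λ ≤ j * Λ := mul_le_mul_of_nonneg_right (by omega) (by positivity)
  linarith

theorem mul_natCast_mono {Λ : ℕ} {i j : ℤ} (h : i ≤ j) : i * Λ ≤ j * Λ :=
  mul_le_mul_of_nonneg_right h (by positivity)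

theorem IsCutOn.mono (h : IsCutOn ϑ p Λ x o m) (hnm : n ≤ m) : IsCutOn ϑ p Λ x o n := by
  obtain ⟨v, hv, hb⟩ := h
  exact ⟨v, hv.of_infix (word_infix (by omega) (by omega)) (by simp [← List.length_eq_zero_iff]),
    fun i h1 h2 => hb i (by omega) (by omega)⟩

theorem IsCutOn.congr (h : IsCutOn ϑ p Λ x o n)
    (hxy : ∀ i : ℤ, o - n * Λ ≤ i → i < o + (n + 1) * Λ → x i = y i) : IsCutOn ϑ p Λ y o n := by
  obtain ⟨v, hv, hb⟩ := h
  refine ⟨v, hv, fun i h1 h2 => ?_⟩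
  rw [← word_congr (x := x)]
  · exact hb i h1 h2
  · intro t h3 h4
    have h5 := mul_natCast_mono (Λ := Λ) h1
    have h6 := add_mul_le_of_lt (Λ := Λ) (show i < n + 1 by omega)
    exact hxy t (by linarith) (by linarith)

/-- There are only `Λ` offsets. If each of them failed on some window, a window containing all of
these could not be cut at all, contrary to `exists_blocks`. -/
theorem exists_forall_isCutOn [Nonempty A] (hp : ϑ.IsPrimitive) {L : ℕ} (h2 : 2 ≤ L)
    (hL : ∀ a, ∀ u ∈ ϑ.image a, u.length = L) (hΛ : L ^ p = Λ) (hx : x ∈ ϑ.subshift) :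
    ∃ o : ℕ, o < Λ ∧ ∀ n, IsCutOn ϑ p Λ x o n := by
  have hpos : 0 < Λ := hΛ ▸ Nat.pow_pos (by omega)
  by_contra! hcon
  have hcon' : ∀ o : ℕ, ∃ n, o < Λ → ¬ IsCutOn ϑ p Λ x o n := by
    intro o
    by_cases ho : o < Λ
    · obtain ⟨n, hn⟩ := hcon o ho
      exact ⟨n, fun _ => hn⟩
    · exact ⟨0, fun h => absurd h ho⟩
  choose N hN using hcon'
  set M := (Finset.range Λ).sup N with hM
  obtain ⟨v, o, ho, hoΛ, hb, hv⟩ := exists_blocks hp h2 hL p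
    (mem_subshift_iff.1 hx (-(M * Λ : ℕ)) ((2 * M + 2) * Λ) (by positivity))
  rw [hΛ] at *
  obtain ⟨o, rfl⟩ := Int.eq_ofNat_of_zero_le ho
  have hoΛ' : o < Λ := by exact_mod_cast hoΛ
  refine hN o hoΛ' (IsCutOn.mono ⟨v, ?_, ?_⟩
    (Finset.le_sup (f := N) (Finset.mem_range.2 hoΛ') : N o ≤ M))
  · refine hv _ _ (by omega) ?_ ?_
    · push_cast
      linarith
    · push_cast
      rw [show (-(M : ℤ) + (2 * M + 1)) = M + 1 by ring]
      linarith
  · intro i h1 h3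
    have h4 := mul_natCast_mono (Λ := Λ) h1
    have h5 := mul_natCast_mono (Λ := Λ) h3
    refine hb i ?_ ?_
    · push_cast
      linarith
    · push_cast
      linarith

/-- Some cylinder consists of sequences that are all cut at one common offset. -/
theorem exists_cylinder [Nonempty A] (hp : ϑ.IsPrimitive) {L : ℕ} (h2 : 2 ≤ L)
    (hL : ∀ a, ∀ u ∈ ϑ.image a, u.length = L) (hΛ : L ^ p = Λ) :
    ∃ x₀ ∈ ϑ.subshift, ∃ (a : ℤ) (N : ℕ) (o : ℤ), ∀ x ∈ ϑ.subshift,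
      word x a N = word x₀ a N → ∀ n, IsCutOn ϑ p Λ x o n := by
  by_contra! hcon
  -- Baire argument: cylinders shrink so as to exclude the offsets below `t`, one at a time. Failure
  -- of an offset shows in a finite window, so it persists on a cylinder. At `t = Λ` no offset
  -- remains.
  have key : ∀ t : ℕ, ∃ x₀ ∈ ϑ.subshift, ∃ N : ℕ, ∀ x ∈ ϑ.subshift,
      (∀ i : ℤ, -N ≤ i → i ≤ N → x i = x₀ i) → ∀ o : ℕ, o < t → ∃ n, ¬ IsCutOn ϑ p Λ x o n := by
    intro t
    induction t with
    | zero =>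
      inhabit A
      obtain ⟨x, hx, -⟩ :=
        exists_mem_subshift_word_eq hp h2 hL (isLegal_singleton ϑ (default : A)) 0
      exact ⟨x, hx, 0, fun _ _ _ o ho => absurd ho (by omega)⟩
    | succ t ih =>
      obtain ⟨x₀, hx₀, N, hN⟩ := ih
      obtain ⟨x₁, hx₁, h01, n, hn⟩ := hcon x₀ hx₀ (-N) (2 * N + 1) t
      -- This radius covers the previous cylinder and all blocks at offset `t` that witness the
      -- failure.
      refine ⟨x₁, hx₁, N + t + (n + 1) * Λ, fun x hx hxx o ho => ?_⟩
      have hpos : (0 : ℤ) ≤ (n + 1) * Λ := by positivity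
      rcases Nat.lt_succ_iff_lt_or_eq.1 ho with ho | rfl
      · refine hN x hx (fun i h3 h4 => ?_) o ho
        rw [hxx i (by push_cast; linarith) (by push_cast; linarith)]
        exact apply_eq_of_word_eq h01 h3 (by push_cast; linarith)
      · refine ⟨n, fun h => hn (h.congr fun i h3 h4 => hxx i ?_ ?_)⟩
        · push_cast
          linarith [show (n : ℤ) * Λ ≤ (n + 1) * Λ by rw [add_mul]; linarith [Int.natCast_nonneg Λ]]
        · push_cast
          linarith
  obtain ⟨x₀, hx₀, N, hN⟩ := key Λ
  obtain ⟨o, ho, hcut⟩ := exists_forall_isCutOn hp h2 hL hΛ hx₀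
  obtain ⟨n, hn⟩ := hN x₀ hx₀ (fun _ _ _ => rfl) o ho
  exact hn (hcut n)

/-- There is a context in which every level-`p` inflation word of some letter can be exchanged for
every other one. -/
theorem exists_exchange [Finite A] [DecidableEq A] [Nonempty A] (hc : ϑ.IsCompatible)
    (hp : ϑ.IsPrimitive) {L : ℕ} (h2 : 2 ≤ L)
    (hL : ∀ a, ∀ u ∈ ϑ.image a, u.length = L) (hΛ : L ^ p = Λ) :
    ∃ (P Q : List A) (c : A), (∃ σ ∈ ϑ.power p c, ϑ.IsLegal (P ++ (σ ++ Q))) ∧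
      ∀ x ∈ ϑ.subshift, ∀ j : ℤ, ∀ σ ∈ ϑ.power p c,
        word x j (P.length + (Λ + Q.length)) = P ++ (σ ++ Q) → ∀ y : ℤ → A,
        (∀ i : ℤ, (i < j + P.length ∨ j + P.length + Λ ≤ i) → y i = x i) →
        word y (j + P.length) Λ ∈ ϑ.power p c → y ∈ ϑ.subshift := by
  classical
  have hpos : 0 < Λ := hΛ ▸ Nat.pow_pos (by omega)
  have hpos' : (0 : ℤ) < Λ := by exact_mod_cast hpos
  have hlen : ∀ a, ∀ u ∈ ϑ.power p a, u.length = Λ := fun a u hu => by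
    rw [length_of_mem_power hL hu, hΛ]
  -- Since `c` has the fewest level-`p` words, an inclusion of `ϑ^p(d)` in `ϑ^p(c)` is an equality.
  -- So every letter violating `R` has an inflation word outside `ϑ^p(c)`.
  obtain ⟨c, hcmin⟩ := Finite.exists_min fun d => (ϑ.power p d).ncard
  let R : A → Prop := fun d => ϑ.power p d = ϑ.power p c
  have hrep : ∀ d, ∃ u ∈ ϑ.power p d, ¬ R d → u ∉ ϑ.power p c := by
    intro d
    by_cases hd : R d
    · obtain ⟨u, hu⟩ := ϑ.power_nonempty p d
      exact ⟨u, hu, fun h => absurd hd h⟩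
    · by_contra! hcon
      exact hd (Set.eq_of_subset_of_ncard_le (fun u hu => (hcon u hu).2) (hcmin d)
        (ϑ.power_finite p c))
  choose rep hrep hrepR using hrep
  obtain ⟨m, hm, hmem⟩ := exists_forall_mem_of_isLegal hc hp h2 hL
  let F : (ℤ → A) → Finset ℕ := fun w => (Finset.range m).filter fun i => ¬ R (w i)
  -- Among the legal words of length `m`, `b` has the most letters violating `R`; `m` is large
  -- enough for `c` to occur in it.
  obtain ⟨b, hb, hbmax⟩ : ∃ b : ℤ → A, ϑ.IsLegal (word b 0 m) ∧
      ∀ w : ℤ → A, ϑ.IsLegal (word w 0 m) → (F w).card ≤ (F b).card := by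
    let S : Set ℕ := {n | ∃ w : ℤ → A, ϑ.IsLegal (word w 0 m) ∧ (F w).card = n}
    have hbdd : BddAbove S := by
      refine ⟨m, ?_⟩
      rintro _ ⟨w, -, rfl⟩
      exact (Finset.card_filter_le _ _).trans (by simp)
    obtain ⟨x, hx, -⟩ := exists_mem_subshift_word_eq hp h2 hL (isLegal_singleton ϑ c) 0
    obtain ⟨b, hb, hb'⟩ := Nat.sSup_mem (s := S) ⟨_, x, mem_subshift_iff.1 hx 0 m hm, rfl⟩ hbdd
    exact ⟨b, hb, fun w hw => hb' ▸ le_csSup hbdd ⟨w, hw, rfl⟩⟩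
  obtain ⟨h, hh, hbh⟩ : ∃ h < m, b h = c := by
    have := hmem b 0 hb c
    simpa [word] using this
  obtain ⟨x₀, hx₀, a, N, o, hcyl⟩ := exists_cylinder hp h2 hL hΛ
  set n : ℕ := o.natAbs + a.natAbs + N with hn
  have hnΛ : (n : ℤ) ≤ n * Λ := le_mul_of_one_le_right (by positivity) (by omega)
  obtain ⟨v, hv, hvb⟩ := hcyl x₀ hx₀ rfl n
  obtain ⟨g, hg⟩ := exists_append_append hp h2 hL hv hb
  obtain ⟨V, hV⟩ := exists_word_eq (word v (-n) (2 * n + 1) ++ g ++ word b 0 m) (-n)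
  set B : ℤ := n + 1 + g.length with hB
  have hV1 : ∀ i : ℤ, -n ≤ i → i ≤ n → V i = v i := by
    have h1 := hV
    rw [List.append_assoc, word_append_iff (by simp [add_assoc])] at h1
    have h1 := h1.1
    rw [length_word] at h1
    intro i h3 h4
    exact apply_eq_of_word_eq h1 h3 (by push_cast; omega)
  have hV2 : ∀ i : ℕ, i < m → V (B + i) = b i := by
    have h1 := hV
    rw [word_append_iff (by simp [add_assoc])] at h1
    have h1 := h1.2
    rw [length_word] at h1
    have h3 := word_eq_word.1 h1
    intro i hi
    have := h3 i hi
    rw [zero_add] at this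
    rw [← this]
    congr 1
    simp
    omega
  -- `z` follows `x₀` up to block `n`, which contains the cylinder word and so fixes the cut. From
  -- there on it inflates `g` and `b` by the representatives `rep`.
  let z : ℤ → A := fun t => if t < o + (n + 1) * Λ then x₀ t else
    (rep (V ((t - o) / Λ))).getD ((t - o) % Λ).toNat c
  have hz1 : ∀ t, t < o + (n + 1) * Λ → z t = x₀ t := fun t ht => if_pos ht
  have hz2 : ∀ i : ℤ, n < i → word z (o + i * Λ) Λ = rep (V i) := by
    intro i hi
    apply List.ext_getElem (by rw [length_word, hlen _ _ (hrep _)])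
    intro k h3 h4
    rw [getElem_word]
    rw [length_word] at h3
    have h5 := mul_natCast_mono (Λ := Λ) (show (n : ℤ) + 1 ≤ i by omega)
    have h6 : o + i * Λ + k - o = k + i * Λ := by ring
    simp only [z]
    rw [if_neg (by linarith), h6, Int.add_mul_ediv_right _ _ hpos'.ne',
      Int.ediv_eq_zero_of_lt (by omega) (by omega), zero_add, Int.add_mul_emod_self_right,
      Int.emod_eq_of_lt (by omega) (by omega)]
    simp [h4]
  set T : ℕ := 2 * n + 1 + g.length + m with hT
  have hZ : ϑ.IsLegal (word z (o + (-n) * Λ) (T * Λ)) := by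
    have hVlen : (word v (-n) (2 * n + 1) ++ g ++ word b 0 m).length = T := by simp [hT, add_assoc]
    rw [hVlen] at hV
    refine hg.conc (p := p) ?_ (by
      rw [ne_eq, ← List.length_eq_zero_iff, length_word]
      positivity)
    rw [← hV]
    refine word_mem_conc T fun i hi => ?_
    have h3 : o + -(n : ℤ) * Λ + i * Λ = o + (-n + i) * Λ := by ring
    rw [h3]
    by_cases hin : (-n + i : ℤ) ≤ n
    · rw [word_congr (y := x₀), hV1 _ (by omega) hin]
      · exact hvb _ (by omega) hin
      · intro t h4 h5
        have := add_mul_le_of_lt (Λ := Λ) (show (-n + i : ℤ) < n + 1 by omega)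
        exact hz1 t (by linarith)
    · rw [hz2 _ (by omega)]
      exact hrep _
  -- The exchangeable block, of type `b h = c`, starts at `H`. The context extends from the cylinder
  -- word at `a` to the end of the inflated `b`.
  set H : ℤ := o + (B + h) * Λ with hH
  have hHn : o + (n + 1) * Λ ≤ H := by
    have := mul_natCast_mono (Λ := Λ) (show (n : ℤ) + 1 ≤ B + h by omega)
    linarith
  have haN : a + N ≤ o + (n + 1) * Λ := by rw [add_mul]; omega
  obtain ⟨k, hk⟩ := Int.eq_ofNat_of_zero_le (show 0 ≤ H - a by omega)
  set q : ℕ := (m - 1 - h) * Λ with hq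
  have hqe : H + Λ + q = o + (B + m) * Λ := by
    rw [hH, hq]
    push_cast [show h ≤ m - 1 by omega, show 1 ≤ m by omega]
    ring
  have hσ : word z H Λ ∈ ϑ.power p c := by
    rw [hH, hz2 _ (by omega), hV2 h hh, hbh]
    exact hrep c
  refine ⟨word z a k, word z (H + Λ) q, c, ⟨word z H Λ, hσ, ?_⟩, ?_⟩
  · have : word z a k ++ (word z H Λ ++ word z (H + Λ) q) = word z a (k + (Λ + q)) := by
      rw [word_add, word_add, ← hk, add_sub_cancel]
    rw [this]
    refine hZ.of_infix (word_infix ?_ ?_) (by simp [← List.length_eq_zero_iff]; omega)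
    · rw [neg_mul]
      omega
    · have h3 : o + -(n : ℤ) * Λ + (T * Λ : ℕ) = o + (B + m) * Λ := by
        rw [hT, hB]
        push_cast
        ring
      rw [h3]
      push_cast
      omega
  · simp only [length_word]
    intro x hx j σ hσ hxw y hyx hy
    have hshift := translate_mem_subshift hx (j - a)
    set x' : ℤ → A := fun i => x (i + (j - a)) with hx'
    have hxw' : word x' a (k + (Λ + q)) = word z a k ++ (σ ++ word z (H + Λ) q) := by
      rw [hx', word_shift, add_sub_cancel, hxw]
    rw [word_append_iff (by simp [hlen _ _ hσ]), word_append_iff (by simp)] at hxw'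
    obtain ⟨h3, -, h4⟩ := hxw'
    simp only [length_word, hlen _ _ hσ, ← hk, add_sub_cancel] at h3 h4
    have hx'z : ∀ t, a ≤ t → t < o + (B + m) * Λ → (t < H ∨ H + Λ ≤ t) → x' t = z t := by
      intro t h5 h6 h7
      rcases h7 with h7 | h7
      · exact apply_eq_of_word_eq h3 h5 (by omega)
      · exact apply_eq_of_word_eq h4 h7 (by omega)
    have hcut := hcyl x' hshift (word_congr fun i h5 h6 => by
      rw [hx'z i h5 (by omega) (by omega), hz1 i (by omega)])
    suffices hs : (fun i => y (i + (j - a))) ∈ ϑ.subshift by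
      have := translate_mem_subshift hs (a - j)
      simpa only [add_assoc, sub_add_sub_cancel, sub_self, add_zero] using this
    set y' : ℤ → A := fun i => y (i + (j - a)) with hy'
    have hyx' : ∀ t, (t < H ∨ H + Λ ≤ t) → y' t = x' t := fun t ht => hyx _ (by omega)
    have hyH : word y' H Λ ∈ ϑ.power p c := by
      rw [hy', word_shift, show H + (j - a) = j + k by omega]
      exact hy
    refine mem_subshift_of_windows fun K => ?_
    set M : ℕ := K + o.natAbs + n + 1 + g.length + m with hM
    have hMΛ : (M : ℤ) ≤ M * Λ := le_mul_of_one_le_right (by positivity) (by omega)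
    obtain ⟨v', hv', hvb'⟩ := hcut M
    -- Where `b` violates `R`, the block lies outside `ϑ^p(c)`, so the type in `v'` violates `R`
    -- too. One more violation at `h` would contradict the maximality of `b`.
    have hR : R (v' (B + h)) := by
      have hw : ϑ.IsLegal (word (fun i => v' (i + B)) 0 m) := by
        rw [word_shift, zero_add]
        exact hv'.of_infix (word_infix (by omega) (by push_cast; omega))
          (by simpa [← List.length_eq_zero_iff] using hm)
      have hsub : F b ⊆ F fun i => v' (i + B) := by
        intro i hi
        simp only [F, Finset.mem_filter, Finset.mem_range] at hi ⊢
        refine ⟨hi.1, fun hRi => ?_⟩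
        have hih : i ≠ h := by
          rintro rfl
          rw [hbh] at hi
          exact hi.2 rfl
        have h5 := hvb' (i + B) (by omega) (by omega)
        rw [hRi, word_congr (y := z), hz2 _ (by omega), add_comm (i : ℤ) B, hV2 i hi.1] at h5
        · exact hrepR _ hi.2 h5
        · intro t h6 h7
          have h8 := mul_natCast_mono (Λ := Λ) (show (n : ℤ) + 1 ≤ i + B by omega)
          have h9 := add_mul_le_of_lt (Λ := Λ) (show i + B < B + m by omega)
          refine hx'z t (by omega) (by omega) ?_
          rcases lt_or_gt_of_ne hih with h10 | h10
          · have := add_mul_le_of_lt (Λ := Λ) (show i + B < B + h by omega)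
            omega
          · have := add_mul_le_of_lt (Λ := Λ) (show B + h < i + B by omega)
            omega
      have heq := Finset.eq_of_subset_of_card_le hsub (hbmax _ hw)
      by_contra hcon
      have : h ∈ F b := by
        rw [heq]
        simp only [F, Finset.mem_filter, Finset.mem_range]
        exact ⟨hh, by rwa [add_comm]⟩
      simp only [F, Finset.mem_filter] at this
      exact this.2 (by rw [hbh])
    refine ⟨o + (-M) * Λ, (2 * M + 1) * Λ, ?_, ?_, hv'.conc (p := p) (word_mem_conc _ ?_) ?_⟩
    · rw [neg_mul]
      omega
    · push_cast
      rw [show o + -(M : ℤ) * Λ + (2 * M + 1) * Λ = o + (M * Λ + Λ) by ring]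
      omega
    · intro i hi
      rw [show o + -(M : ℤ) * Λ + i * Λ = o + (-M + i) * Λ by ring]
      rcases lt_trichotomy (-M + i : ℤ) (B + h) with h5 | h5 | h5
      · rw [word_congr (y := x')]
        · exact hvb' _ (by omega) (by omega)
        · intro t h6 h7
          have := add_mul_le_of_lt (Λ := Λ) h5
          exact hyx' t (by omega)
      · rw [h5, hR]
        exact hyH
      · rw [word_congr (y := x')]
        · exact hvb' _ (by omega) (by omega)
        · intro t h6 h7
          have := add_mul_le_of_lt (Λ := Λ) h5
          exact hyx' t (by omega)
    · rw [ne_eq, ← List.length_eq_zero_iff, length_word]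
      positivity

end Cutting

end RandomSubstitution

namespace RandomSubstitution

/-! ### Contexts whose occurrences are separated. -/

section Splice

variable {A : Type*}

/-- The sequence `x` with the word `u` written at position `a`. -/
def splice (x : ℤ → A) (a : ℤ) (u : List A) (t : ℤ) : A :=
  if a ≤ t ∧ t < a + u.length then u.getD (t - a).toNat (x t) else x t

theorem splice_of_lt {x : ℤ → A} {a t : ℤ} {u : List A} (h : t < a ∨ a + u.length ≤ t) :
    splice x a u t = x t :=
  if_neg (by omega)

theorem word_splice {x : ℤ → A} {a : ℤ} {u : List A} {n : ℕ} (hn : u.length = n) :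
    word (splice x a u) a n = u := by
  subst hn
  apply List.ext_getElem (by simp)
  intro i h1 h2
  rw [getElem_word]
  simp [splice, h2]

end Splice

/-- A context `P _ Q` such that all the words `e i` can be exchanged for each other inside it, and
such that the words `e i` in different occurrences of the context do not meet these occurrences. -/
structure FrameSystem {A : Type*} (ϑ : RandomSubstitution A) (I : Type*) where
  /-- The part of the context on the left. -/
  P : List A
  /-- The part of the context on the right. -/
  Q : List A
  /-- The common length of the contents. -/
  Λ : ℕ
  /-- The possible contents. -/
  e : I → List A
  e_injective : Function.Injective e
  length_e : ∀ i, (e i).length = Λ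
  isLegal : ∀ i, ϑ.IsLegal (P ++ (e i ++ Q))
  exchange : ∀ x ∈ ϑ.subshift, ∀ (j : ℤ) (i : I),
    word x j (P.length + (Λ + Q.length)) = P ++ (e i ++ Q) → ∀ y : ℤ → A,
      (∀ t : ℤ, (t < j + P.length ∨ j + P.length + Λ ≤ t) → y t = x t) →
      ∀ i', word y (j + P.length) Λ = e i' → y ∈ ϑ.subshift
  separated : ∀ (x : ℤ → A) (j j' : ℤ) (i i' : I),
    word x j (P.length + (Λ + Q.length)) = P ++ (e i ++ Q) →
    word x j' (P.length + (Λ + Q.length)) = P ++ (e i' ++ Q) → j < j' →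
      j + P.length + Λ ≤ j' ∧ j + Λ + Q.length ≤ j'

/-- The context of `exists_exchange` is lengthened to the left so that it starts with the last
marker `m` before `P`, where `m` occurs nowhere around `P` and `Q` for any of the contents. If two
occurrences came too close, the marker of the second would be a forbidden later marker inside the
first. -/
theorem exists_frameSystem {A : Type*} {ϑ : RandomSubstitution A} [Finite A] [DecidableEq A]
    [Nonempty A] (hc : ϑ.IsCompatible) (hn : ϑ.IsNondegenerate)
    (hp : ϑ.IsPrimitive) {L : ℕ} (h2 : 2 ≤ L) (hL : ∀ a, ∀ u ∈ ϑ.image a, u.length = L)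
    (I : Type*) [Fintype I] [Nonempty I] : Nonempty (FrameSystem ϑ I) := by
  classical
  obtain ⟨p, hpI⟩ := exists_lt_ncard_power hc hp hn h2 hL (Fintype.card I)
  obtain ⟨Λ, hΛ⟩ : ∃ Λ, L ^ p = Λ := ⟨_, rfl⟩
  have hlen : ∀ a, ∀ u ∈ ϑ.power p a, u.length = Λ := fun a u hu => by
    rw [length_of_mem_power hL hu, hΛ]
  obtain ⟨P, Q, c, ⟨σ, hσ, hPQ⟩, hex⟩ := exists_exchange hc hp h2 hL hΛ
  obtain ⟨e, he, hec⟩ : ∃ e : I → List A, Function.Injective e ∧ ∀ i, e i ∈ ϑ.power p c := by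
    have hfin := ϑ.power_finite p c
    have hcard : Fintype.card I ≤ Fintype.card hfin.toFinset := by
      rw [Fintype.card_coe, ← Set.ncard_eq_toFinset_card _ hfin]
      refine le_trans ?_ (hpI c).le
      exact Nat.le_mul_of_pos_right _ (by positivity)
    obtain ⟨f⟩ := Function.Embedding.nonempty_of_card_le hcard
    exact ⟨fun i => (f i).1, fun i i' h => f.injective (Subtype.ext h),
      fun i => hfin.mem_toFinset.1 (f i).2⟩
  have hel : ∀ i, (e i).length = Λ := fun i => hlen _ _ (hec i)
  set n₀ := P.length + (Λ + Q.length) with hn₀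
  obtain ⟨x₁, hx₁, hx₁w⟩ := exists_mem_subshift_word_eq hp h2 hL hPQ 0
  rw [List.length_append, List.length_append, hlen _ _ hσ, ← hn₀] at hx₁w
  -- This constant beats the number of bad words, at most `card I * (n₀ + l + 1)`.
  obtain ⟨q, hq⟩ := exists_lt_ncard_power hc hp hn h2 hL (Fintype.card I + n₀ + 1)
  obtain ⟨l, hl⟩ : ∃ l, L ^ q = l := ⟨_, rfl⟩
  rw [hl] at hq
  let bad : Finset (List A) := (Finset.univ ×ˢ Finset.range (n₀ + l + 1)).image
    fun s : I × ℕ => word (splice x₁ P.length (e s.1)) (-l + s.2) l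
  obtain ⟨m, hm, hmbad⟩ : ∃ m ∈ ϑ.power q c, m ∉ (bad : Set (List A)) := by
    refine Set.exists_mem_notMem_of_ncard_lt_ncard (lt_of_le_of_lt ?_ (hq c))
      (Finset.finite_toSet _)
    rw [Set.ncard_coe_finset]
    refine Finset.card_image_le.trans ?_
    rw [Finset.card_product, Finset.card_univ, Finset.card_range]
    exact Nat.mul_le_mul (by omega) (by omega)
  have hml : m.length = l := by rw [length_of_mem_power hL hm, hl]
  have hl0 : 0 < l := hl ▸ Nat.pow_pos (by omega)
  have hmleg : ϑ.IsLegal m := isLegal_of_mem_power hm (by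
    rw [← List.length_pos_iff]
    omega)
  obtain ⟨g, hg⟩ := exists_append_append hp h2 hL hmleg
    (mem_subshift_iff.1 hx₁ (-l) (l + n₀ + l) (by omega))
  obtain ⟨y, hy, hyw⟩ := exists_mem_subshift_word_eq hp h2 hL hg (-l - g.length - l)
  rw [word_append_iff (by simp [add_assoc]), word_append_iff (by simp)] at hyw
  obtain ⟨⟨hym, -⟩, hyx⟩ := hyw
  rw [List.length_append, hml, length_word, show (-l - g.length - l + (l + g.length : ℕ) : ℤ) = -l by
    push_cast; ring] at hyx
  rw [hml] at hym
  have hyx₁ : ∀ t : ℤ, -l ≤ t → t < n₀ + l → y t = x₁ t := fun t h1 h3 =>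
    apply_eq_of_word_eq hyx h1 (by push_cast; omega)
  obtain ⟨j₀, ⟨hj₀, hj₀m⟩, hmax⟩ := Int.exists_greatest_of_bdd
    (P := fun s => s ≤ -l ∧ word y s l = m) ⟨-l, fun _ h => h.1⟩ ⟨_, by omega, hym⟩
  obtain ⟨r, hr⟩ := Int.eq_ofNat_of_zero_le (show 0 ≤ -j₀ by omega)
  have hyPQ : word y 0 n₀ = P ++ (σ ++ Q) := by
    rw [← hx₁w]
    exact word_congr fun i h1 h3 => hyx₁ i (by omega) (by omega)
  obtain ⟨hyP, hyQ⟩ := (word_append_iff (by simp [hn₀, hlen _ _ hσ])).1 hyPQ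
  obtain ⟨-, hyQ⟩ := (word_append_iff (by simp)).1 hyQ
  rw [hlen _ _ hσ, zero_add] at hyQ
  set P₁ := word y j₀ r with hP₁
  set Q₁ := word y n₀ l with hQ₁
  have hP₁l : P₁.length = r := length_word _ _ _
  have hQ₁l : Q₁.length = l := length_word _ _ _
  have hys : ∀ i, word (splice y P.length (e i)) j₀ (r + (n₀ + l)) = P₁ ++ P ++ (e i ++ (Q ++ Q₁)) := by
    intro i
    rw [word_append_iff (by simp [hel, hP₁l, hQ₁l, hn₀]; ring),
      word_append_iff (by simp), word_append_iff (by simp), word_append_iff (by simp), hP₁l, hQ₁l,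
      hel, List.length_append, hP₁l, show j₀ + (r + P.length : ℕ) = P.length by omega,
      show j₀ + r = 0 by omega]
    refine ⟨⟨?_, ?_⟩, word_splice (hel i), ?_, ?_⟩
    · exact word_congr fun t h1 h3 => splice_of_lt (by omega)
    · rw [← hyP, length_word]
      exact word_congr fun t h1 h3 => splice_of_lt (by omega)
    · conv_rhs => rw [← hyQ]
      exact word_congr fun t h1 h3 => splice_of_lt (by rw [hel]; omega)
    · rw [show (P.length + Λ + Q.length : ℤ) = n₀ by rw [hn₀]; push_cast; ring]
      exact word_congr fun t h1 h3 => splice_of_lt (by rw [hel]; omega)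
  have hN : (P₁ ++ P).length + (Λ + (Q ++ Q₁).length) = r + (n₀ + l) := by
    rw [List.length_append, List.length_append, hP₁l, hQ₁l]
    omega
  refine ⟨⟨P₁ ++ P, Q ++ Q₁, Λ, e, he, hel, fun i => ?_, fun x hx j i hxw z hzx i' hz => ?_,
    fun x j j' i i' hxj hxj' hjj' => ?_⟩⟩
  · rw [← hys i]
    refine mem_subshift_iff.1 ?_ _ _ (by omega)
    refine hex y hy 0 σ hσ hyPQ _ (fun t ht => splice_of_lt ?_) ?_
    · rw [hel]
      omega
    · rw [zero_add, word_splice (hel i)]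
      exact hec i
  · refine hex x hx (j + r) (e i) (hec i) ?_ z (fun t ht => hzx t ?_) ?_
    · rw [show P₁ ++ P ++ (e i ++ (Q ++ Q₁)) = P₁ ++ ((P ++ (e i ++ Q)) ++ Q₁) by simp,
        word_append_iff (by simp [hel, hP₁l, hQ₁l]; ring),
        word_append_iff (v := Q₁) (by simp [add_assoc]), hP₁l] at hxw
      have := hxw.2.1
      rwa [List.length_append, List.length_append, hel] at this
    · rw [List.length_append, hP₁l]
      push_cast
      omega
    · rw [List.length_append, hP₁l] at hz
      push_cast at hz
      rw [add_assoc, hz]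
      exact hec i'
  · by_contra hcon
    -- At larger distances separation holds, the right-hand condition because `r ≥ l`. Up to this
    -- distance the marker that opens the second occurrence lies entirely inside the first: either
    -- in the part before `P`, against the choice of `j₀`, or at a place counted in `bad`.
    have hd : j' - j ≤ r + n₀ := by
      by_contra! hlt
      refine hcon ⟨?_, ?_⟩
      · rw [List.length_append, hP₁l]
        push_cast
        omega
      · rw [List.length_append, hQ₁l]
        push_cast
        omega
    have hxm : word x j' l = m := by
      rw [hN, ← hys i', show r + (n₀ + l) = l + (r + n₀) by ring, word_add x,
        word_add (splice _ _ _)] at hxj'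
      rw [(List.append_inj hxj' (by simp)).1, ← hj₀m]
      exact word_congr fun t h1 h3 => splice_of_lt (by omega)
    have hxy : word (splice y P.length (e i)) (j₀ + (j' - j)) l = m := by
      rw [hN, ← hys i] at hxj
      rw [← hxm]
      refine word_eq_word.2 fun s hs => ?_
      have := word_eq_word.1 hxj (j' - j + s).toNat (by omega)
      rw [show j + ((j' - j + s).toNat : ℤ) = j' + s by omega,
        show j₀ + ((j' - j + s).toNat : ℤ) = j₀ + (j' - j) + s by omega] at this
      exact this.symm
    rcases le_or_gt (j₀ + (j' - j)) (-l) with h1 | h1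
    · have := hmax (j₀ + (j' - j)) ⟨h1, by
        rw [← hxy]
        exact word_congr fun t h3 h4 => (splice_of_lt (by omega)).symm⟩
      omega
    · apply hmbad
      rw [Finset.mem_coe, Finset.mem_image]
      refine ⟨(i, (j₀ + (j' - j) + l).toNat), ?_, ?_⟩
      · simp only [Finset.mem_product, Finset.mem_univ, Finset.mem_range, true_and]
        omega
      · rw [← hxy]
        simp only
        rw [show -(l : ℤ) + ((j₀ + (j' - j) + l).toNat : ℤ) = j₀ + (j' - j) by omega]
        refine word_congr fun t h3 h4 => ?_
        simp only [splice]
        rw [hyx₁ t (by omega) (by omega)]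

end RandomSubstitution

namespace RandomSubstitution

/-! ### Rewriting the contents of all contexts. -/

namespace FrameSystem

variable {A I : Type*} {ϑ : RandomSubstitution A} (F : FrameSystem ϑ I)

/-- The context of `F` occurs in `x` at position `j`, with content `e i`. -/
def IsFrame (x : ℤ → A) (j : ℤ) (i : I) : Prop :=
  word x j (F.P.length + (F.Λ + F.Q.length)) = F.P ++ (F.e i ++ F.Q)

/-- The context of `F` occurs in `x` at position `j`, with some content. -/
def HasFrame (x : ℤ → A) (j : ℤ) : Prop := ∃ i, F.IsFrame x j i

/-- The position `t` belongs to the content of a context at position `j`. -/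
def InHole (j t : ℤ) : Prop := j + F.P.length ≤ t ∧ t < j + F.P.length + F.Λ

open Classical in
/-- The content of the context at position `j`. -/
noncomputable def content [Nonempty I] (x : ℤ → A) (j : ℤ) : I :=
  if h : F.HasFrame x j then h.choose else Classical.arbitrary I

open Classical in
/-- The sequence `x`, with the contents of the contexts at the positions in `S` replaced. -/
noncomputable def rewriteOn (S : Set ℤ) (x : ℤ → A) (h : ℤ → I) (t : ℤ) : A :=
  if ht : ∃ j ∈ S, F.InHole j t then
    (F.e (h ht.choose)).getD (t - ht.choose - F.P.length).toNat (x t) else x t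

/-- The sequence `x`, with the contents of all contexts replaced. -/
noncomputable def rewrite (x : ℤ → A) (h : ℤ → I) : ℤ → A := F.rewriteOn {j | F.HasFrame x j} x h

variable {F} {x y : ℤ → A} {i i' : I} {j j' t : ℤ} {h h' : ℤ → I} {S : Set ℤ}

theorem isFrame_iff : F.IsFrame x j i ↔ word x j F.P.length = F.P ∧
    word x (j + F.P.length) F.Λ = F.e i ∧ word x (j + F.P.length + F.Λ) F.Q.length = F.Q := by
  rw [IsFrame, word_append_iff (by rw [List.length_append, F.length_e]),
    word_append_iff (by rw [List.length_append]), F.length_e]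

theorem IsFrame.hasFrame (hx : F.IsFrame x j i) : F.HasFrame x j := ⟨i, hx⟩

theorem IsFrame.unique (hx : F.IsFrame x j i) (hx' : F.IsFrame x j i') : i = i' :=
  F.e_injective ((isFrame_iff.1 hx).2.1.symm.trans (isFrame_iff.1 hx').2.1)

theorem HasFrame.isFrame_content [Nonempty I] (hx : F.HasFrame x j) :
    F.IsFrame x j (F.content x j) := by
  rw [content, dif_pos hx]
  exact hx.choose_spec

theorem IsFrame.content_eq [Nonempty I] (hx : F.IsFrame x j i) : F.content x j = i :=
  hx.hasFrame.isFrame_content.unique hx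

theorem content_eq_content [Nonempty I] (hxy : ∀ i, F.IsFrame x j i ↔ F.IsFrame y j' i) :
    F.content x j = F.content y j' := by
  by_cases hx : F.HasFrame x j
  · obtain ⟨i, hi⟩ := hx
    rw [hi.content_eq, ((hxy i).1 hi).content_eq]
  · have hy : ¬ F.HasFrame y j' := fun ⟨i, hi⟩ => hx ⟨i, (hxy i).2 hi⟩
    rw [content, content, dif_neg hx, dif_neg hy]

theorem HasFrame.separated (hx : F.HasFrame x j) (hx' : F.HasFrame x j') (hj : j < j') :
    j + F.P.length + F.Λ ≤ j' ∧ j + F.Λ + F.Q.length ≤ j' := by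
  obtain ⟨i, hi⟩ := hx
  obtain ⟨i', hi'⟩ := hx'
  exact F.separated x j j' i i' hi hi' hj

/-- The two inequalities in `separated` say that a content avoids whole contexts on its right and on
its left, and not merely their contents. Hence rewriting one content leaves every other context
intact. -/
theorem HasFrame.eq_of_inHole (hx : F.HasFrame x j) (hx' : F.HasFrame x j') (ht : F.InHole j t)
    (hjt : j' ≤ t) (hjt' : t < j' + F.P.length + F.Λ + F.Q.length) : j' = j := by
  obtain ⟨h1, h2⟩ := ht
  rcases lt_trichotomy j j' with hj | hj | hj
  · have := hx.separated hx' hj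
    omega
  · exact hj.symm
  · have := hx'.separated hx hj
    omega

theorem HasFrame.congr (hx : F.HasFrame x j)
    (hxy : ∀ t, j ≤ t → t < j + F.P.length + F.Λ + F.Q.length → y t = x t) : F.HasFrame y j := by
  obtain ⟨i, hi⟩ := hx
  refine ⟨i, ?_⟩
  rw [IsFrame, ← hi]
  exact word_congr fun t h1 h2 => hxy t h1 (by push_cast at h2; omega)

theorem IsFrame.congr (hx : F.IsFrame x j i)
    (hxy : ∀ t, j ≤ t → t < j + F.P.length + F.Λ + F.Q.length → y t = x t) : F.IsFrame y j i := by
  rw [IsFrame, ← hx]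
  exact word_congr fun t h1 h2 => hxy t h1 (by push_cast at h2; omega)

theorem HasFrame.isFrame_of_word (hx : F.HasFrame x j)
    (hxy : ∀ t, (∀ j, F.HasFrame x j → ¬ F.InHole j t) → y t = x t)
    (hy : word y (j + F.P.length) F.Λ = F.e i) : F.IsFrame y j i := by
  obtain ⟨i₀, hi₀⟩ := id hx
  rw [isFrame_iff] at hi₀ ⊢
  refine ⟨?_, hy, ?_⟩
  · conv_rhs => rw [← hi₀.1]
    refine word_congr fun t h1 h2 => hxy t fun j' hj' ht => ?_
    have := hj'.eq_of_inHole hx ht h1 (by omega)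
    subst this
    have := ht.1
    omega
  · conv_rhs => rw [← hi₀.2.2]
    refine word_congr fun t h1 h2 => hxy t fun j' hj' ht => ?_
    have := hj'.eq_of_inHole hx ht (by omega) (by omega)
    subst this
    have := ht.2
    omega

/-- Exchanging contents creates and destroys no contexts. -/
theorem hasFrame_iff (hxy : ∀ t, (∀ j, F.HasFrame x j → ¬ F.InHole j t) → y t = x t)
    (hy : ∀ j, F.HasFrame x j → ∃ i, word y (j + F.P.length) F.Λ = F.e i) :
    F.HasFrame y j ↔ F.HasFrame x j := by
  have key : ∀ j, F.HasFrame x j → F.HasFrame y j := fun j hx => by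
    obtain ⟨i, hi⟩ := hy j hx
    exact ⟨i, hx.isFrame_of_word hxy hi⟩
  refine ⟨fun hj => ?_, key j⟩
  by_contra hcon
  -- If the new context met the content of an old one, the old one would survive in `y` by `key`,
  -- and separation in `y` would identify the two.
  refine hcon (hj.congr fun t h1 h2 => (hxy t fun j' hj' ht => hcon ?_).symm)
  rwa [(key j' hj').eq_of_inHole hj ht h1 h2]

theorem rewriteOn_of_not_inHole (ht : ∀ j ∈ S, ¬ F.InHole j t) : F.rewriteOn S x h t = x t :=
  dif_neg fun ⟨j, hj, hjt⟩ => ht j hj hjt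

theorem getElem?_rewriteOn (hS : ∀ j ∈ S, F.HasFrame x j) (hj : j ∈ S) (ht : F.InHole j t) :
    (F.e (h j))[(t - j - F.P.length).toNat]? = some (F.rewriteOn S x h t) := by
  have hex : ∃ j ∈ S, F.InHole j t := ⟨j, hj, ht⟩
  obtain ⟨h1, h2⟩ := hex.choose_spec
  have heq : hex.choose = j := by
    have := h2.1
    have := h2.2
    exact (hS j hj).eq_of_inHole (hS _ h1) ht (by omega) (by omega)
  have hlen : (t - j - F.P.length).toNat < (F.e (h j)).length := by
    rw [F.length_e]
    have := ht.1
    have := ht.2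
    omega
  rw [rewriteOn, dif_pos hex, heq, List.getD_eq_getElem?_getD, List.getElem?_eq_getElem hlen,
    Option.getD_some]

theorem word_rewriteOn (hS : ∀ j ∈ S, F.HasFrame x j) (hj : j ∈ S) :
    word (F.rewriteOn S x h) (j + F.P.length) F.Λ = F.e (h j) := by
  apply List.ext_getElem (by simp [F.length_e])
  intro n h1 h2
  rw [length_word] at h1
  rw [getElem_word]
  apply Option.some_injective
  rw [← getElem?_rewriteOn hS hj ⟨by omega, by omega⟩, ← List.getElem?_eq_getElem]
  congr 1
  omega

/-- Induction on `S`: `exchange` treats one content at a time, and the remaining contexts are still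
present afterwards. -/
theorem rewriteOn_finset_mem (hx : x ∈ ϑ.subshift) (S : Finset ℤ)
    (hS : ∀ j ∈ S, F.HasFrame x j) : F.rewriteOn (S : Set ℤ) x h ∈ ϑ.subshift := by
  induction S using Finset.induction_on with
  | empty =>
    have : F.rewriteOn ((∅ : Finset ℤ) : Set ℤ) x h = x :=
      funext fun t => rewriteOn_of_not_inHole (by simp)
    rwa [this]
  | insert j S hjS ih =>
    have hS' : ∀ j ∈ (S : Set ℤ), F.HasFrame x j := fun j hj =>
      hS j (Finset.mem_insert_of_mem hj)
    have hj : F.HasFrame x j := hS j (Finset.mem_insert_self j S)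
    obtain ⟨i, hi⟩ := id hj
    have hfr : F.IsFrame (F.rewriteOn (S : Set ℤ) x h) j i := by
      refine hi.congr fun t h1 h2 => rewriteOn_of_not_inHole fun j' hj' ht => hjS ?_
      rwa [(hS' j' hj').eq_of_inHole hj ht h1 h2]
    refine F.exchange _ (ih hS') j i hfr _ (fun t ht => ?_) (h j)
      (word_rewriteOn (fun j hj => hS j (by simpa using hj)) (by simp))
    by_cases hex : ∃ j' ∈ S, F.InHole j' t
    · obtain ⟨j', hj', hjt⟩ := hex
      apply Option.some_injective
      rw [← getElem?_rewriteOn hS' hj' hjt,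
        ← getElem?_rewriteOn (fun j hj => hS j (by simpa using hj)) (by simp [hj']) hjt]
    · rw [rewriteOn_of_not_inHole (fun j' hj' hjt => hex ⟨j', hj', hjt⟩),
        rewriteOn_of_not_inHole]
      intro j' hj' hjt
      rw [Finset.mem_coe, Finset.mem_insert] at hj'
      rcases hj' with rfl | hj'
      · have := hjt.1
        have := hjt.2
        omega
      · exact hex ⟨j', hj', hjt⟩

theorem getElem?_rewrite (hj : F.HasFrame x j) (ht : F.InHole j t) :
    (F.e (h j))[(t - j - F.P.length).toNat]? = some (F.rewrite x h t) :=
  getElem?_rewriteOn (fun _ hj => hj) hj ht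

theorem rewrite_of_not_inHole (ht : ∀ j, F.HasFrame x j → ¬ F.InHole j t) :
    F.rewrite x h t = x t :=
  rewriteOn_of_not_inHole ht

/-- Membership is tested on finite windows, and a finite window meets finitely many contents. -/
theorem rewrite_mem (hx : x ∈ ϑ.subshift) : F.rewrite x h ∈ ϑ.subshift := by
  classical
  rw [mem_subshift_iff]
  intro a n hn
  let S : Finset ℤ :=
    (Finset.Icc (a - F.P.length - F.Λ) (a + n)).filter fun j => F.HasFrame x j
  have hS : ∀ j ∈ S, F.HasFrame x j := fun j hj => (Finset.mem_filter.1 hj).2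
  rw [← word_congr (x := F.rewriteOn (S : Set ℤ) x h)]
  · exact mem_subshift_iff.1 (rewriteOn_finset_mem hx S hS) a n hn
  · intro t h1 h2
    by_cases hex : ∃ j, F.HasFrame x j ∧ F.InHole j t
    · obtain ⟨j, hj, hjt⟩ := hex
      have hjS : j ∈ S := by
        have := hjt.1
        have := hjt.2
        exact Finset.mem_filter.2 ⟨Finset.mem_Icc.2 ⟨by omega, by omega⟩, hj⟩
      apply Option.some_injective
      rw [← getElem?_rewriteOn hS hjS hjt, ← getElem?_rewrite hj hjt]
    · rw [rewrite_of_not_inHole fun j hj hjt => hex ⟨j, hj, hjt⟩,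
        rewriteOn_of_not_inHole fun j hj hjt => hex ⟨j, hS j hj, hjt⟩]

theorem isFrame_rewrite (hj : F.HasFrame x j) : F.IsFrame (F.rewrite x h) j (h j) :=
  hj.isFrame_of_word (fun _ ht => rewrite_of_not_inHole ht)
    (word_rewriteOn (S := {j | F.HasFrame x j}) (fun _ hj => hj) hj)

theorem hasFrame_rewrite_iff : F.HasFrame (F.rewrite x h) j ↔ F.HasFrame x j :=
  hasFrame_iff (fun _ ht => rewrite_of_not_inHole ht) fun j hj =>
    ⟨h j, word_rewriteOn (S := {j | F.HasFrame x j}) (fun _ hj => hj) hj⟩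

theorem content_rewrite [Nonempty I] (hj : F.HasFrame x j) :
    F.content (F.rewrite x h) j = h j :=
  (isFrame_rewrite hj).content_eq

theorem rewrite_congr (hh : ∀ j, F.HasFrame x j → h j = h' j) : F.rewrite x h = F.rewrite x h' := by
  funext t
  by_cases hex : ∃ j, F.HasFrame x j ∧ F.InHole j t
  · obtain ⟨j, hj, hjt⟩ := hex
    apply Option.some_injective
    rw [← getElem?_rewrite hj hjt, ← getElem?_rewrite hj hjt, hh j hj]
  · rw [rewrite_of_not_inHole fun j hj hjt => hex ⟨j, hj, hjt⟩,
      rewrite_of_not_inHole fun j hj hjt => hex ⟨j, hj, hjt⟩]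

theorem rewrite_rewrite : F.rewrite (F.rewrite x h) h' = F.rewrite x h' := by
  funext t
  by_cases hex : ∃ j, F.HasFrame x j ∧ F.InHole j t
  · obtain ⟨j, hj, hjt⟩ := hex
    apply Option.some_injective
    rw [← getElem?_rewrite hj hjt, ← getElem?_rewrite (hasFrame_rewrite_iff.2 hj) hjt]
  · rw [rewrite_of_not_inHole fun j hj hjt => hex ⟨j, hasFrame_rewrite_iff.1 hj, hjt⟩,
      rewrite_of_not_inHole fun j hj hjt => hex ⟨j, hj, hjt⟩,
      rewrite_of_not_inHole fun j hj hjt => hex ⟨j, hj, hjt⟩]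

theorem rewrite_content [Nonempty I] : F.rewrite x (F.content x) = x := by
  funext t
  by_cases hex : ∃ j, F.HasFrame x j ∧ F.InHole j t
  · obtain ⟨j, hj, hjt⟩ := hex
    apply Option.some_injective
    have h1 := hjt.1
    have h2 := hjt.2
    rw [← getElem?_rewrite hj hjt, ← (isFrame_iff.1 hj.isFrame_content).2.1,
      List.getElem?_eq_getElem (by rw [length_word]; omega), getElem_word]
    congr 2
    omega
  · rw [rewrite_of_not_inHole fun j hj hjt => hex ⟨j, hj, hjt⟩]

theorem isFrame_translate {b : ℤ} :
    F.IsFrame (fun t => x (t + b)) j i ↔ F.IsFrame x (j + b) i := by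
  rw [IsFrame, IsFrame, word_shift]

theorem hasFrame_translate {b : ℤ} :
    F.HasFrame (fun t => x (t + b)) j ↔ F.HasFrame x (j + b) := by
  simp only [HasFrame, isFrame_translate]

theorem content_translate [Nonempty I] {b : ℤ} :
    F.content (fun t => x (t + b)) j = F.content x (j + b) :=
  content_eq_content fun _ => isFrame_translate

theorem rewrite_translate {b : ℤ} :
    F.rewrite (fun t => x (t + b)) (fun j => h (j + b)) = fun t => F.rewrite x h (t + b) := by
  funext t
  by_cases hex : ∃ j, F.HasFrame x j ∧ F.InHole j (t + b)
  · obtain ⟨j, hj, hjt⟩ := hex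
    obtain ⟨j, rfl⟩ : ∃ j', j = j' + b := ⟨j - b, by ring⟩
    have h1 := hjt.1
    have h2 := hjt.2
    apply Option.some_injective
    rw [← getElem?_rewrite hj hjt, ← getElem?_rewrite (j := j) (hasFrame_translate.2 hj)
      ⟨by omega, by omega⟩]
    congr 1
    omega
  · rw [rewrite_of_not_inHole fun j hj hjt => hex ⟨j, hj, hjt⟩,
      rewrite_of_not_inHole fun j hj hjt => hex ⟨j + b, hasFrame_translate.1 hj, ?_⟩]
    have h1 := hjt.1
    have h2 := hjt.2
    exact ⟨by omega, by omega⟩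

/-- Rewriting is a local rule, which is the source of continuity for the flips. -/
theorem rewrite_apply_congr
    (hxy : ∀ s, t - F.P.length - F.Λ ≤ s → s ≤ t + F.P.length + F.Λ + F.Q.length → x s = y s)
    (hh : ∀ j, t - F.P.length - F.Λ ≤ j → j ≤ t → h j = h' j) :
    F.rewrite x h t = F.rewrite y h' t := by
  have hfr : ∀ j, F.InHole j t → (F.HasFrame x j ↔ F.HasFrame y j) := by
    intro j hj
    have h1 := hj.1
    have h2 := hj.2
    exact ⟨fun h => h.congr fun s h3 h4 => (hxy s (by omega) (by omega)).symm,
      fun h => h.congr fun s h3 h4 => hxy s (by omega) (by omega)⟩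
  by_cases hex : ∃ j, F.HasFrame x j ∧ F.InHole j t
  · obtain ⟨j, hj, hjt⟩ := hex
    have h1 := hjt.1
    have h2 := hjt.2
    apply Option.some_injective
    rw [← getElem?_rewrite hj hjt, ← getElem?_rewrite ((hfr j hjt).1 hj) hjt,
      hh j (by omega) (by omega)]
  · rw [rewrite_of_not_inHole fun j hj hjt => hex ⟨j, hj, hjt⟩,
      rewrite_of_not_inHole fun j hj hjt => hex ⟨j, (hfr j hjt).2 hj, hjt⟩]
    exact hxy t (by omega) (by omega)

theorem content_congr [Nonempty I]
    (hxy : ∀ s, j ≤ s → s ≤ j + F.P.length + F.Λ + F.Q.length → x s = y s) :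
    F.content x j = F.content y j :=
  content_eq_content fun _ => ⟨fun h => h.congr fun s h1 h2 => (hxy s h1 h2.le).symm,
    fun h => h.congr fun s h1 h2 => hxy s h1 h2.le⟩

end FrameSystem

end RandomSubstitution

namespace RandomSubstitution

/-! ### The flips, and words in them that act non-trivially. -/

namespace FrameSystem

variable {A ι : Type*} {ϑ : RandomSubstitution A} (F : FrameSystem ϑ (Option ι × Bool))

/-- A context whose content has label `i` is controlled in `x` if one of the contexts at most `D`
positions further to the right has a different label and the bit `true`. -/
def Active (D : ℕ) (i : ι) (x : ℤ → A) (j : ℤ) : Prop :=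
  (F.content x j).1 = some i ∧ ∃ j', j < j' ∧ j' ≤ j + D ∧ F.HasFrame x j' ∧
    (F.content x j').1 ≠ some i ∧ (F.content x j').2 = true

open Classical in
/-- The contents of the contexts after flipping the bits of the active ones. -/
noncomputable def toggle (D : ℕ) (i : ι) (x : ℤ → A) (j : ℤ) : Option ι × Bool :=
  if F.Active D i x j then ((F.content x j).1, !(F.content x j).2) else F.content x j

/-- Flip the bits of all active contexts. -/
noncomputable def flip (D : ℕ) (i : ι) (x : ℤ → A) : ℤ → A := F.rewrite x (F.toggle D i x)

variable {F} {D : ℕ} {i : ι} {x y : ℤ → A} {j t : ℤ}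

theorem toggle_fst : (F.toggle D i x j).1 = (F.content x j).1 := by
  rw [toggle]
  split_ifs <;> rfl

theorem toggle_of_fst_ne (h : (F.content x j).1 ≠ some i) :
    F.toggle D i x j = F.content x j :=
  if_neg fun ha => h ha.1

theorem hasFrame_flip_iff : F.HasFrame (F.flip D i x) j ↔ F.HasFrame x j := hasFrame_rewrite_iff

theorem content_flip (hj : F.HasFrame x j) : F.content (F.flip D i x) j = F.toggle D i x j :=
  content_rewrite hj

/-- Activity for `i` depends on positions, labels and bits at labels other than `i`, none of which
the flip changes. This makes the flip an involution. -/
theorem active_flip_iff (hj : F.HasFrame x j) :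
    F.Active D i (F.flip D i x) j ↔ F.Active D i x j := by
  rw [Active, Active, content_flip hj, toggle_fst]
  refine and_congr_right fun _ => exists_congr fun j' => and_congr_right fun _ =>
    and_congr_right fun _ => ?_
  rw [hasFrame_flip_iff]
  refine and_congr_right fun hj' => ?_
  rw [content_flip hj', toggle_fst]
  refine and_congr_right fun h => ?_
  rw [toggle_of_fst_ne h]

theorem flip_flip : F.flip D i (F.flip D i x) = x := by
  have h : ∀ j, F.HasFrame x j → F.toggle D i (F.flip D i x) j = F.content x j := by
    intro j hj
    by_cases ha : F.Active D i x j
    · rw [toggle, if_pos ((active_flip_iff hj).2 ha), content_flip hj, toggle, if_pos ha]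
      simp
    · rw [toggle, if_neg (mt (active_flip_iff hj).1 ha), content_flip hj, toggle, if_neg ha]
  calc F.flip D i (F.flip D i x) = F.rewrite x (F.toggle D i (F.flip D i x)) := rewrite_rewrite
    _ = F.rewrite x (F.content x) := rewrite_congr h
    _ = x := rewrite_content

theorem flip_mem (hx : x ∈ ϑ.subshift) : F.flip D i x ∈ ϑ.subshift := rewrite_mem hx

theorem toggle_translate {b : ℤ} :
    F.toggle D i (fun t => x (t + b)) j = F.toggle D i x (j + b) := by
  have : F.Active D i (fun t => x (t + b)) j ↔ F.Active D i x (j + b) := by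
    simp only [Active, content_translate, hasFrame_translate]
    refine and_congr_right fun _ => ⟨?_, ?_⟩
    · rintro ⟨j', h1, h2, h3⟩
      exact ⟨j' + b, by omega, by omega, h3⟩
    · rintro ⟨j', h1, h2, h3⟩
      refine ⟨j' - b, by omega, by omega, ?_⟩
      rwa [sub_add_cancel]
  rw [toggle, toggle, content_translate]
  classical exact if_congr this rfl rfl

theorem flip_translate {b : ℤ} :
    F.flip D i (fun t => x (t + b)) = fun t => F.flip D i x (t + b) := by
  rw [flip, show F.toggle D i (fun t => x (t + b)) = fun j => F.toggle D i x (j + b) from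
    funext fun _ => toggle_translate, rewrite_translate]
  rfl

theorem toggle_congr
    (hxy : ∀ s, j ≤ s → s ≤ j + D + F.P.length + F.Λ + F.Q.length → x s = y s) :
    F.toggle D i x j = F.toggle D i y j := by
  have hc : ∀ j', j ≤ j' → j' ≤ j + D → F.content x j' = F.content y j' := fun j' h1 h2 =>
    content_congr fun s h3 h4 => hxy s (by omega) (by omega)
  have hf : ∀ j', j ≤ j' → j' ≤ j + D → (F.HasFrame x j' ↔ F.HasFrame y j') := fun j' h1 h2 =>
    ⟨fun h => h.congr fun s h3 h4 => (hxy s (by omega) (by omega)).symm,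
      fun h => h.congr fun s h3 h4 => hxy s (by omega) (by omega)⟩
  have hcj := hc j le_rfl (by omega)
  have ha : F.Active D i x j ↔ F.Active D i y j := by
    rw [Active, Active, hcj]
    refine and_congr_right fun _ => exists_congr fun j' => and_congr_right fun h1 =>
      and_congr_right fun h2 => ?_
    rw [hc j' h1.le h2, hf j' h1.le h2]
  rw [toggle, toggle, hcj]
  classical exact if_congr ha rfl rfl

theorem flip_apply_congr
    (hxy : ∀ s, t - F.P.length - F.Λ ≤ s → s ≤ t + D + F.P.length + F.Λ + F.Q.length → x s = y s) :
    F.flip D i x t = F.flip D i y t :=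
  rewrite_apply_congr (fun s h1 h2 => hxy s h1 (by omega)) fun j h1 h2 =>
    toggle_congr fun s h3 h4 => hxy s (by omega) (by omega)

theorem continuous_flip [TopologicalSpace A] [DiscreteTopology A] :
    Continuous (F.flip D i) := by
  refine continuous_pi fun t => ?_
  refine (IsLocallyConstant.iff_exists_open _).2 (fun x => ?_) |>.continuous
  refine ⟨(Set.Icc (t - F.P.length - F.Λ) (t + D + F.P.length + F.Λ + F.Q.length)).pi
    fun s => {x s}, isOpen_set_pi (Set.finite_Icc _ _) fun _ _ => isOpen_discrete _,
    fun s _ => rfl, fun y hy => ?_⟩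
  exact flip_apply_congr fun s h1 h2 => hy s ⟨h1, h2⟩

variable (F) in
/-- The automorphism of the subshift that flips the bits of the active contexts. -/
noncomputable def flipAut [TopologicalSpace A] [DiscreteTopology A] (D : ℕ) (i : ι) :
    ϑ.autGroup where
  val :=
    { toFun := fun x => ⟨F.flip D i x.1, flip_mem x.2⟩
      invFun := fun x => ⟨F.flip D i x.1, flip_mem x.2⟩
      left_inv := fun _ => Subtype.ext flip_flip
      right_inv := fun _ => Subtype.ext flip_flip
      continuous_toFun := (continuous_flip.comp continuous_subtype_val).subtype_mk _
      continuous_invFun := (continuous_flip.comp continuous_subtype_val).subtype_mk _ }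
  property := fun _ => Subtype.ext flip_translate

theorem flipAut_mul_self [TopologicalSpace A] [DiscreteTopology A] :
    F.flipAut D i * F.flipAut D i = 1 :=
  Subtype.ext (Homeomorph.ext fun _ => Subtype.ext flip_flip)

/-- Along a chain of contexts, each of which sees exactly the preceding one, a reduced word in the
flips transports the bit `true` from the first context to the last one. -/
theorem exists_foldr_flip_ne {r : ℕ} {x : ℤ → A} (hx : x ∈ ϑ.subshift) (j : ℕ → ℤ)
    (hj : ∀ n ≤ r, F.HasFrame x (j n)) (hlt : ∀ n, j (n + 1) < j n)
    (hnear : ∀ n, j n ≤ j (n + 1) + D) (hfar : ∀ n, j (n + 2) + D < j n) (l : List ι)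
    (hl : l.IsChain (· ≠ ·)) (hlr : l.length = r) (hr : r ≠ 0) :
    ∃ y ∈ ϑ.subshift, l.foldr (F.flip D) y ≠ y := by
  classical
  have hanti : StrictAnti j := strictAnti_nat_of_succ_lt hlt
  -- Only the rightmost context `j 0` starts with bit `true`. As `foldr` applies the last letter
  -- first, `j n` is labelled by the `n`-th letter of `l` from the end. Contexts outside the chain
  -- have label `none` and never become active.
  let h : ℤ → Option ι × Bool := fun t =>
    if hex : ∃ n, n ≤ r ∧ j n = t then
      if hex.choose = 0 then (none, true) else (l[r - hex.choose]?, false)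
    else (none, false)
  have hh : ∀ n ≤ r, h (j n) = if n = 0 then (none, true) else (l[r - n]?, false) := by
    intro n hn
    have hex : ∃ m, m ≤ r ∧ j m = j n := ⟨n, hn, rfl⟩
    have : hex.choose = n := hanti.injective hex.choose_spec.2
    simp only [h]
    rw [dif_pos hex, this]
  have hh' : ∀ t, (∀ n ≤ r, j n ≠ t) → h t = (none, false) := by
    intro t ht
    exact dif_neg fun ⟨n, hn, hnt⟩ => ht n hn hnt
  set y := F.rewrite x h with hy
  have hfy : ∀ t, F.HasFrame y t ↔ F.HasFrame x t := fun t => hasFrame_rewrite_iff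
  have hcy : ∀ t, F.HasFrame x t → F.content y t = h t := fun t ht => content_rewrite ht
  -- After `n` letters the bit `true` has reached `j n` and no context beyond it; positions and
  -- labels are unchanged.
  have key : ∀ n ≤ r, (∀ t, F.HasFrame ((l.drop (r - n)).foldr (F.flip D) y) t ↔ F.HasFrame x t) ∧
      (∀ t, F.HasFrame x t →
        (F.content ((l.drop (r - n)).foldr (F.flip D) y) t).1 = (h t).1) ∧
      (F.content ((l.drop (r - n)).foldr (F.flip D) y) (j n)).2 = true ∧
      ∀ t, F.HasFrame x t → (F.content ((l.drop (r - n)).foldr (F.flip D) y) t).2 = true →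
        ∃ m ≤ n, t = j m := by
    intro n
    induction n with
    | zero =>
      intro _
      rw [Nat.sub_zero, ← hlr, List.drop_length, List.foldr_nil]
      refine ⟨hfy, fun t ht => by rw [hcy t ht], ?_, fun t ht htrue => ?_⟩
      · rw [hcy _ (hj 0 (by omega)), hh 0 (by omega), if_pos rfl]
      · rw [hcy t ht] at htrue
        by_cases hex : ∃ n, n ≤ r ∧ j n = t
        · obtain ⟨n, hn, rfl⟩ := hex
          rw [hh n hn] at htrue
          split_ifs at htrue with hn0
          exact ⟨0, le_rfl, by rw [hn0]⟩
        · rw [hh' t fun n hn hnt => hex ⟨n, hn, hnt⟩] at htrue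
          simp at htrue
    | succ n ih =>
      intro hn
      obtain ⟨ih1, ih2, ih3, ih4⟩ := ih (by omega)
      have hlt' : r - (n + 1) < l.length := by omega
      have hdrop : l.drop (r - (n + 1)) = l[r - (n + 1)] :: l.drop (r - n) := by
        rw [List.drop_eq_getElem_cons hlt', show r - (n + 1) + 1 = r - n by omega]
      rw [hdrop, List.foldr_cons]
      set z := (l.drop (r - n)).foldr (F.flip D) y with hz
      set i := l[r - (n + 1)] with hi
      have hlab : (h (j (n + 1))).1 = some i := by
        rw [hh _ hn, if_neg (by omega), List.getElem?_eq_getElem hlt']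
      have hlab' : (h (j n)).1 ≠ some i := by
        rw [hh _ (by omega)]
        split_ifs with hn0
        · simp
        · have hlt2 : r - n < l.length := by omega
          rw [List.getElem?_eq_getElem hlt2]
          have := List.isChain_iff_getElem.1 hl (r - (n + 1)) (by omega)
          simp only [show r - (n + 1) + 1 = r - n by omega] at this
          intro heq
          exact this (Option.some_injective _ heq).symm
      have hjn := hj n (by omega)
      have hjn1 := hj (n + 1) hn
      refine ⟨fun t => hasFrame_flip_iff.trans (ih1 t), fun t ht => ?_, ?_, fun t ht htrue => ?_⟩
      · rw [content_flip ((ih1 t).2 ht), toggle_fst, ih2 t ht]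
      · rw [content_flip ((ih1 _).2 hjn1), toggle, if_pos]
        · have : (F.content z (j (n + 1))).2 = false := by
            by_contra hcon
            obtain ⟨m, hm, hmj⟩ := ih4 _ hjn1 (by simpa using hcon)
            have := hanti.injective hmj
            omega
          simp [this]
        · refine ⟨by rw [ih2 _ hjn1, hlab], j n, hlt n, hnear n, (ih1 _).2 hjn, ?_, ih3⟩
          rw [ih2 _ hjn]
          exact hlab'
      · rw [content_flip ((ih1 t).2 ht), toggle] at htrue
        split_ifs at htrue with ha
        · obtain ⟨ha1, t', h1, h2, h3, -, h5⟩ := ha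
          rw [ih2 t ht] at ha1
          obtain ⟨m', hm', rfl⟩ := ih4 t' ((ih1 t').1 h3) h5
          by_cases hex : ∃ m, m ≤ r ∧ j m = t
          · obtain ⟨m, hm, rfl⟩ := hex
            refine ⟨m, ?_, rfl⟩
            -- Two or more steps beyond the front, `hfar` puts every `true` bit out of sight.
            by_contra! hmn
            have h6 := hfar (m - 2)
            rw [show m - 2 + 2 = m by omega] at h6
            have h7 := hanti.antitone (show m' ≤ m - 2 by omega)
            omega
          · rw [hh' t fun n hn hnt => hex ⟨n, hn, hnt⟩] at ha1
            simp at ha1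
        · obtain ⟨m, hm, rfl⟩ := ih4 t ht htrue
          exact ⟨m, by omega, rfl⟩
  refine ⟨y, rewrite_mem hx, fun heq => ?_⟩
  have h3 := (key r le_rfl).2.2.1
  rw [Nat.sub_self, List.drop_zero, heq, hcy _ (hj r le_rfl), hh r le_rfl, if_neg hr] at h3
  simp at h3

/-- At a common level every letter has an inflation word containing the context, so a sequence can
be built with one in each block of length `Λ`. With every second block, neighbours are more than `Λ`
and less than `3 * Λ` apart, and two steps exceed `3 * Λ = D`. -/
theorem exists_hasFrame_chain {I : Type*} [Nonempty I] (F : FrameSystem ϑ I) (hp : ϑ.IsPrimitive)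
    {L : ℕ} (h2 : 2 ≤ L) (hL : ∀ a, ∀ u ∈ ϑ.image a, u.length = L) :
    ∃ D : ℕ, ∀ r : ℕ, ∃ x ∈ ϑ.subshift, ∃ j : ℕ → ℤ, (∀ n ≤ r, F.HasFrame x (j n)) ∧
      (∀ n, j (n + 1) < j n) ∧ (∀ n, j n ≤ j (n + 1) + D) ∧ ∀ n, j (n + 2) + D < j n := by
  obtain ⟨i⟩ := ‹Nonempty I›
  have hleg := F.isLegal i
  obtain ⟨p, hpw⟩ := hp.exists_infix hleg
  choose w hw s t hst using hpw p le_rfl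
  obtain ⟨Λ, hΛ⟩ : ∃ Λ, L ^ p = Λ := ⟨_, rfl⟩
  have hwl : ∀ b, (w b).length = Λ := fun b => by rw [length_of_mem_power hL (hw b), hΛ]
  have hpos' : (0 : ℤ) < Λ := by exact_mod_cast hΛ ▸ Nat.pow_pos (by omega)
  have hs : ∀ b, (s b).length < Λ := by
    intro b
    rw [← hwl b, ← hst b]
    have := List.length_pos_iff.2 hleg.1
    simp only [List.length_append] at this ⊢
    omega
  obtain ⟨-, a, -⟩ := id hleg
  obtain ⟨v, hv, -⟩ := exists_mem_subshift_word_eq hp h2 hL (isLegal_singleton ϑ a) 0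
  refine ⟨3 * Λ, fun r => ?_⟩
  set N : ℕ := 2 * r + 1 with hN
  let z : ℤ → A := fun t => (w (v (t / Λ))).getD (t % Λ).toNat a
  have hz : ∀ i : ℤ, word z (i * Λ) Λ = w (v i) := by
    intro i
    apply List.ext_getElem (by simp [hwl])
    intro k h3 h4
    rw [getElem_word]
    rw [length_word] at h3
    simp only [z]
    rw [add_comm, Int.add_mul_ediv_right _ _ hpos'.ne', Int.ediv_eq_zero_of_lt (by omega) (by omega),
      zero_add, Int.add_mul_emod_self_right, Int.emod_eq_of_lt (by omega) (by omega)]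
    simp [h4]
  have hNΛ : N * Λ ≠ 0 := Nat.mul_ne_zero (by omega) (by omega)
  have hzl : ϑ.IsLegal (word z 0 (N * Λ)) := by
    refine (mem_subshift_iff.1 hv 0 N (by omega)).conc (p := p) (word_mem_conc N fun i hi => ?_) ?_
    · rw [zero_add, zero_add, hz]
      exact hw _
    · simpa [← List.length_eq_zero_iff] using hNΛ
  obtain ⟨x, hx, hxz⟩ := exists_mem_subshift_word_eq hp h2 hL hzl 0
  rw [length_word] at hxz
  have hfr : ∀ n : ℕ, n < N → F.HasFrame x (n * Λ + (s (v n)).length) := by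
    intro n hn
    refine ⟨i, ?_⟩
    have h3 : word x (n * Λ) (w (v n)).length = s (v n) ++ (F.P ++ (F.e i ++ F.Q) ++ t (v n)) := by
      rw [← List.append_assoc, hst, ← hz, length_word]
      refine word_congr fun t h4 h5 => apply_eq_of_word_eq hxz ?_ ?_
      · exact le_trans (by positivity) h4
      · have := add_mul_le_of_lt (Λ := Λ) (show (n : ℤ) < N by exact_mod_cast hn)
        push_cast
        linarith
    rw [word_append_iff (by rw [← hst]; simp only [List.length_append]; ring),
      word_append_iff (by simp only [List.length_append])] at h3
    have h4 := h3.2.1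
    rwa [List.length_append, List.length_append, F.length_e] at h4
  refine ⟨x, hx, fun n => (2 * r - 2 * n : ℤ) * Λ + (s (v (2 * r - 2 * n))).length,
    fun n hn => ?_, fun n => ?_, fun n => ?_, fun n => ?_⟩
  · have := hfr (2 * r - 2 * n) (by omega)
    push_cast [show 2 * n ≤ 2 * r by omega] at this
    exact this
  all_goals
    have h3 := hs (v (2 * r - 2 * n))
    have h4 := hs (v (2 * r - 2 * (n + 1 : ℕ)))
    have h5 := hs (v (2 * r - 2 * (n + 2 : ℕ)))
    push_cast at *
    nlinarith

end FrameSystem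

/-! ### Free products generated by involutions. -/

/-- A group element whose square is trivial is the image of the generator of `ℤ/2ℤ`. -/
def homOfMulSelfEqOne {G : Type*} [Group G] (g : G) (hg : g * g = 1) :
    Multiplicative (ZMod 2) →* G where
  toFun a := if a = 1 then 1 else g
  map_one' := if_pos rfl
  map_mul' a b := by
    have h : ∀ a : Multiplicative (ZMod 2), a = 1 ∨ a = Multiplicative.ofAdd 1 := by decide
    have h1 : Multiplicative.ofAdd (1 : ZMod 2) ≠ 1 := by decide
    have h2 : Multiplicative.ofAdd (1 : ZMod 2) * Multiplicative.ofAdd (1 : ZMod 2) = 1 := by decide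
    rcases h a with rfl | rfl <;> rcases h b with rfl | rfl <;> simp [h1, h2, hg]

theorem homOfMulSelfEqOne_of_ne {G : Type*} [Group G] {g : G} (hg : g * g = 1)
    {a : Multiplicative (ZMod 2)} (ha : a ≠ 1) : homOfMulSelfEqOne g hg a = g := if_neg ha

/-- Involutions of which no reduced product is trivial generate a free product. -/
theorem injective_lift_homOfMulSelfEqOne {ι G : Type*} [DecidableEq ι] [Group G] (g : ι → G)
    (hg : ∀ i, g i * g i = 1)
    (hred : ∀ l : List ι, l ≠ [] → l.IsChain (· ≠ ·) → (l.map g).prod ≠ 1) :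
    Function.Injective (Monoid.CoprodI.lift fun i => homOfMulSelfEqOne (g i) (hg i)) := by
  classical
  rw [injective_iff_map_eq_one]
  intro a ha
  obtain ⟨w, rfl⟩ : ∃ w : Monoid.CoprodI.Word fun _ : ι => Multiplicative (ZMod 2), w.prod = a :=
    ⟨Monoid.CoprodI.Word.equiv a, Monoid.CoprodI.Word.equiv.symm_apply_apply a⟩
  by_contra hw
  refine hred (w.toList.map Sigma.fst) ?_ ?_ ?_
  · intro h
    apply hw
    rw [List.map_eq_nil_iff] at h
    rw [Monoid.CoprodI.Word.prod, h]
    rfl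
  · rw [List.isChain_map]
    exact w.chain_ne
  · rw [← ha, Monoid.CoprodI.Word.prod, map_list_prod, List.map_map, List.map_map]
    congr 1
    refine List.map_congr_left fun s hs => ?_
    simp only [Function.comp_apply, Monoid.CoprodI.lift_of]
    exact (homOfMulSelfEqOne_of_ne (hg s.1) (w.ne_one s hs)).symm

/-- The free products of copies of `ℤ/2ℤ` embed into the automorphism group. No recognisable word is
needed: the argument only uses contexts in which inflation words can be exchanged, and these exist
by `exists_exchange` because compatibility controls the letter counts of legal words. -/
theorem exists_injective_coprodI {A : Type*} [Finite A] [DecidableEq A] [TopologicalSpace A]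
    [DiscreteTopology A] {ϑ : RandomSubstitution A} (hlength : ϑ.IsConstantLength)
    (hp : ϑ.IsPrimitive) (hc : ϑ.IsCompatible) (hn : ϑ.IsNondegenerate) (k : ℕ) :
    ∃ f : Monoid.CoprodI (fun _ : Fin k => Multiplicative (ZMod 2)) →* ϑ.autGroup,
      Function.Injective f := by
  obtain ⟨L, hL⟩ := hlength
  have h2 := two_le_length hc hn hL
  have : Nonempty A := let ⟨a, _⟩ := hn; ⟨a⟩
  obtain ⟨F⟩ := exists_frameSystem hc hn hp h2 hL (Option (Fin k) × Bool)
  obtain ⟨D, hD⟩ := F.exists_hasFrame_chain hp h2 hL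
  refine ⟨_, injective_lift_homOfMulSelfEqOne (fun i => F.flipAut D i)
    (fun _ => FrameSystem.flipAut_mul_self) fun l hl0 hl heq => ?_⟩
  obtain ⟨x, hx, j, hj, hlt, hnear, hfar⟩ := hD l.length
  obtain ⟨y, hy, hne⟩ := FrameSystem.exists_foldr_flip_ne hx j hj hlt hnear hfar l hl rfl
    (by simpa using hl0)
  have key : ∀ l : List (Fin k), ((l.map fun i => F.flipAut D i).prod.1 ⟨y, hy⟩).1 =
      l.foldr (F.flip D) y := by
    intro l
    induction l with
    | nil => rfl
    | cons i l ih =>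
      rw [List.foldr_cons, ← ih, List.map_cons, List.prod_cons]
      rfl
  apply hne
  rw [← key, heq]
  rfl

end RandomSubstitution

/-! ### Free groups inside free products of involutions. -/

namespace RandomSubstitution

/-- The automorphism of a free group that inverts the generators. -/
def invertGenerators (α : Type*) : MulAut (FreeGroup α) :=
  let f : FreeGroup α →* FreeGroup α := FreeGroup.lift fun a => (FreeGroup.of a)⁻¹
  have h : f.comp f = MonoidHom.id _ := FreeGroup.ext_hom _ _ fun a => by simp [f]
  MonoidHom.toMulEquiv f f h h

theorem invertGenerators_of {α : Type*} (a : α) :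
    invertGenerators α (FreeGroup.of a) = (FreeGroup.of a)⁻¹ := by
  simp [invertGenerators]

theorem invertGenerators_mul_self (α : Type*) :
    invertGenerators α * invertGenerators α = 1 := by
  ext x
  have h : (invertGenerators α).toMonoidHom.comp (invertGenerators α).toMonoidHom =
      MonoidHom.id _ := FreeGroup.ext_hom _ _ fun a => by simp [invertGenerators_of]
  exact DFunLike.congr_fun h x

/-- The free group of rank two embeds into the free product of three copies of `ℤ/2ℤ`. -/
theorem exists_injective_freeGroup_coprodI :
    ∃ f : FreeGroup Bool →* Monoid.CoprodI (fun _ : Fin 3 => Multiplicative (ZMod 2)),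
      Function.Injective f := by
  let t := homOfMulSelfEqOne _ (invertGenerators_mul_self Bool)
  have ht : t (Multiplicative.ofAdd 1) = invertGenerators Bool :=
    homOfMulSelfEqOne_of_ne _ (by decide)
  have h2 : Multiplicative.ofAdd (1 : ZMod 2) * Multiplicative.ofAdd (1 : ZMod 2) = 1 := by decide
  let G := FreeGroup Bool ⋊[t] Multiplicative (ZMod 2)
  let w : Fin 3 → FreeGroup Bool := ![1, FreeGroup.of false, FreeGroup.of true]
  -- These are involutions because the acting generator inverts each `w o`. The products `s 1 * s 0`
  -- and `s 2 * s 0` are the free generators, so composing with `φ` recovers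
  -- `SemidirectProduct.inl`.
  let s : Fin 3 → G := fun o => ⟨w o, Multiplicative.ofAdd 1⟩
  have hs : ∀ o, s o * s o = 1 := by
    intro o
    apply SemidirectProduct.ext
    · change w o * t (Multiplicative.ofAdd 1) (w o) = 1
      rw [ht]
      fin_cases o <;> simp [w, invertGenerators_of]
    · exact h2
  let φ : Monoid.CoprodI (fun _ : Fin 3 => Multiplicative (ZMod 2)) →* G :=
    Monoid.CoprodI.lift fun o => homOfMulSelfEqOne (s o) (hs o)
  let u : Fin 3 → Monoid.CoprodI (fun _ : Fin 3 => Multiplicative (ZMod 2)) := fun o =>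
    Monoid.CoprodI.of (M := fun _ : Fin 3 => Multiplicative (ZMod 2)) (i := o)
      (Multiplicative.ofAdd 1)
  have hu : ∀ o, φ (u o) = s o := fun o => by
    simp only [φ, u, Monoid.CoprodI.lift_of]
    exact homOfMulSelfEqOne_of_ne _ (by decide)
  refine ⟨FreeGroup.lift fun a : Bool => u (if a then 2 else 1) * u 0, ?_⟩
  have hcomp : φ.comp (FreeGroup.lift fun a : Bool => u (if a then 2 else 1) * u 0) =
      (SemidirectProduct.inl : FreeGroup Bool →* G) := by
    refine FreeGroup.ext_hom _ _ fun a => ?_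
    rw [MonoidHom.comp_apply, FreeGroup.lift_apply_of, map_mul, hu, hu]
    apply SemidirectProduct.ext
    · change w (if a then 2 else 1) * t (Multiplicative.ofAdd 1) (w 0) = FreeGroup.of a
      cases a <;> simp [w]
    · exact h2
  have hinj : Function.Injective (φ.comp (FreeGroup.lift fun a : Bool => u (if a then 2 else 1) * u 0)) := by
    rw [hcomp]
    exact SemidirectProduct.inl_injective
  rw [MonoidHom.coe_comp] at hinj
  exact hinj.of_comp

/-- The free group of countably infinite rank embeds into the free group of rank two. -/
theorem exists_injective_freeGroup_int :
    ∃ f : FreeGroup ℤ →* FreeGroup Bool, Function.Injective f := by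
  let c : MulAut (FreeGroup ℤ) := FreeGroup.freeGroupCongr (Equiv.addRight 1)
  have hc : ∀ n : ℤ, (c ^ n) (FreeGroup.of 0) = FreeGroup.of n := by
    have h1 : ∀ m, c (FreeGroup.of m) = FreeGroup.of (m + 1) := fun m => by simp [c]
    have h3 : ∀ m, c⁻¹ (FreeGroup.of m) = FreeGroup.of (m - 1) := fun m => by
      apply c.injective
      rw [MulAut.apply_inv_self, h1, sub_add_cancel]
    intro n
    induction n with
    | zero => rfl
    | succ n ih => rw [add_comm, zpow_one_add, MulAut.mul_apply, ih, h1, add_comm]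
    | pred n ih => rw [sub_eq_add_neg, add_comm, zpow_add, zpow_neg_one, MulAut.mul_apply, ih, h3,
        sub_eq_add_neg, add_comm]
  let t : Multiplicative ℤ →* MulAut (FreeGroup ℤ) := zpowersHom _ c
  -- Here `a` shifts the generators, so the conjugate of generator 0 by `a ^ n` is generator `n`.
  -- The conjugates chosen in `g` are therefore free.
  let G := FreeGroup ℤ ⋊[t] Multiplicative ℤ
  let a : G := SemidirectProduct.inr (Multiplicative.ofAdd 1)
  let φ : FreeGroup Bool →* G :=
    FreeGroup.lift fun b => if b then a else SemidirectProduct.inl (FreeGroup.of 0)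
  let g : FreeGroup ℤ →* FreeGroup Bool := FreeGroup.lift fun n =>
    FreeGroup.of true ^ n * FreeGroup.of false * (FreeGroup.of true ^ n)⁻¹
  have hcomp : φ.comp g = (SemidirectProduct.inl : FreeGroup ℤ →* G) := by
    refine FreeGroup.ext_hom _ _ fun n => ?_
    have ha : a ^ n = SemidirectProduct.inr (Multiplicative.ofAdd n) := by
      rw [← map_zpow, ← ofAdd_zsmul, smul_eq_mul, mul_one]
    rw [MonoidHom.comp_apply, FreeGroup.lift_apply_of, map_mul, map_mul, map_inv, map_zpow]
    simp only [φ, FreeGroup.lift_apply_of, if_true, Bool.false_eq_true, if_false]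
    rw [ha, ← map_inv, ← SemidirectProduct.inl_aut]
    congr 1
    exact hc n
  refine ⟨g, ?_⟩
  have hinj : Function.Injective (φ.comp g) := by
    rw [hcomp]
    exact SemidirectProduct.inl_injective
  rw [MonoidHom.coe_comp] at hinj
  exact hinj.of_comp

theorem exists_injective_freeGroup_nat_coprodI :
    ∃ f : FreeGroup ℕ →* Monoid.CoprodI (fun _ : Fin 3 => Multiplicative (ZMod 2)),
      Function.Injective f := by
  obtain ⟨f, hf⟩ := exists_injective_freeGroup_int
  obtain ⟨g, hg⟩ := exists_injective_freeGroup_coprodI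
  exact ⟨(g.comp f).comp (FreeGroup.map ((↑) : ℕ → ℤ)),
    (hg.comp hf).comp (FreeGroup.map_injective Nat.cast_injective)⟩

end RandomSubstitution

theorem theorem5 {A : Type*} [Finite A] [DecidableEq A] [TopologicalSpace A] [DiscreteTopology A]
    (ϑ : RandomSubstitution A)
    (hlength : ϑ.IsConstantLength) (hprimitive : ϑ.IsPrimitive) (hcompatible : ϑ.IsCompatible)
    (hnondegenerate : ϑ.IsNondegenerate)
    (hrecognisable : ∃ u : List A, ϑ.IsRecognisableWord u)
    (k : ℕ) (hk : 1 ≤ k) :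
    (∃ f : Monoid.CoprodI (fun _ : Fin k => Multiplicative (ZMod 2)) →* ϑ.autGroup,
      Function.Injective f) ∧
    (∃ f : FreeGroup (Fin k) →* ϑ.autGroup, Function.Injective f) ∧
    (∃ f : FreeGroup ℕ →* ϑ.autGroup, Function.Injective f) := by
  have hfree := fun k =>
    RandomSubstitution.exists_injective_coprodI hlength hprimitive hcompatible hnondegenerate k
  -- Three factors serve for the free groups of every rank, independently of `k`.
  obtain ⟨f, hf⟩ := hfree 3
  obtain ⟨g, hg⟩ := RandomSubstitution.exists_injective_freeGroup_nat_coprodI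
  exact ⟨hfree k, ⟨(f.comp g).comp (FreeGroup.map Fin.val),
    (hf.comp hg).comp (FreeGroup.map_injective Fin.val_injective)⟩, f.comp g, hf.comp hg⟩
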